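/- **Setting.** Let $n$ workers and a server minimize $f=\frac1n\sum_{i=1}^n f_i$ over $\mathbb R^d$ from $x^0=0$. For $0\le\mu\le L$, $\Delta\ge 0$, $\mathcal F^{\Delta}_{L,\mu}$ is the class of $(f_i)_{i=1}^n$ with $\frac\mu2\|y-x\|^2\le f_i(y)-f_i(x)-\langle\nabla f_i(x),y-x\rangle\le\frac L2\|y-x\|^2$ for all $x,y,i$, and $\|x^0-x^\star\|^2\le\Delta$ for some minimizer $x^\star$ of $f$; put $\kappa=L/\mu$. $\mathcal U_\omega$ is the set of families of random maps $(C_i)_{i=1}^n$ on $\mathbb R^d$ with $\mathbb E[C_i(x)]=x$ and $\mathbb E\|C_i(x)-x\|^2\le\omega\|x\|^2$ for all $x,i$; within a round the $C_i$ may depend on each other arbitrarily, and different rounds use fresh randomness. In a linear-spanning algorithm, in round $t=1,2,\dots$ the server broadcasts $u^t$, worker $i$ queries $\nabla f_i$ on a set $\mathcal Y_i^t$ and sends $\hat v_i^t=C_i(v_i^t)$, and the server outputs $\hat x^t$, where $u^t\in\mathrm{span}\{u^r,\hat v_j^r: r<t,\ j\le n\}$; $\mathcal Y_i^t\subseteq\mathrm{span}(\{u^r\}_{r\le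 t}\cup\{\nabla f_i(y):y\in\mathcal Y_i^r,r<t\}\cup\{\hat v_i^r\}_{r<t})$; $v_i^t\in\mathrm{span}(\{u^r\}_{r\le t}\cup\{\nabla f_i(y):y\in\mathcal Y_i^r,r\le t\}\cup\{\hat v_i^r\}_{r<t})$; $\hat x^t\in\mathrm{span}\{u^r,\hat v_j^r:r\le t,\ j\le n\}$; also $\hat x^0=0$. The algorithm may be randomized; the server's decisions use only what it has received, and those of worker $i$ only $f_i$, the broadcasts and its own compressed messages. Let $T_\epsilon=\min\{t\in\mathbb N:\mathbb E[f(\hat x^t)]-\min f\le\epsilon\}$ ($\infty$ if there is none). The per-round cost of $C_i$ at precision $r\ge1$ is the least $b$ such that one fixed decoder recovers, for every $x\in[-1,1]^d$, almost surely $C_i(x)$ from some $b$-bit word up to an error of at most $2^{-r}$ in each entry ($\infty$ if there is none). For a family of compressors it is the common value (in general the maximum) of the costs of its members, and $\mathrm{TCC}_\epsilon$ is the per-round cost of the family times $T_\epsilon$. **Theorem.** Unbiased compression alone does not reduce the order of the total communication cost ($r$ being regarded as a constant): 1. There is an absolute constant $c>0$ such that every member of every family in $\mathcal U_\omega$ has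 per-round cost at least $c\,d/(1+\omega)$, for all $n$, $d$, $\omega\ge0$ and $r\ge1$. 2. (Strongly convex.) For every $\kappa_0>1$ there are $c,c_0,K>0$ depending only on $\kappa_0$ such that for all $\mu,\Delta>0$, $L\ge\kappa_0\mu$, $\omega\ge0$, $0<\epsilon\le c_0\mu\Delta$, all sufficiently large $d$ (depending on $L,\mu,\Delta,\omega,\epsilon$), and all $n\ge2$, there are $(f_i)\in\mathcal F^\Delta_{L,\mu}$ and $(C_i)\in\mathcal U_\omega$ such that, at every precision $r\ge1$, all $C_i$ have the same per-round cost, which is at most $K\frac{d}{1+\omega}(r+\log_2(1+\omega))$, and every linear-spanning algorithm on $\{(f_i,C_i)\}$ satisfies $$T_\epsilon\ge c(1+\omega)\sqrt{\kappa}\,\ln\frac{\mu\Delta}{\epsilon},\qquad \mathrm{TCC}_\epsilon\ge c\,d\,\sqrt{\kappa}\,\ln\frac{\mu\Delta}{\epsilon}\quad\text{for all } r\ge1.$$ 3. (Generally convex.) There are absolute constants $c,c_0,K>0$ such that for all $L,\Delta>0$, $\omega\ge0$, $0<\epsilon\le c_0L\Delta$, all sufficiently large $d$ (depending on $L,\Delta,\omega,\epsilon$),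 and all $n\ge2$, there are $(f_i)\in\mathcal F^\Delta_{L,0}$ and $(C_i)\in\mathcal U_\omega$, with equal per-round costs bounded as in 2, such that every linear-spanning algorithm on $\{(f_i,C_i)\}$ satisfies $$T_\epsilon\ge c(1+\omega)\sqrt{\frac{L\Delta}{\epsilon}},\qquad \mathrm{TCC}_\epsilon\ge c\,d\,\sqrt{\frac{L\Delta}{\epsilon}}\quad\text{for all } r\ge1.$$ 4. These orders, which do not depend on $\omega$, are those of uncompressed methods. The family $C_i=\mathrm{id}$ belongs to $\mathcal U_\omega$ for all $\omega\ge0$, and there are absolute constants $c_0,K>0$ such that for all $n\ge1$, $d$ and $L\ge\mu>0$ there is one algorithm that, with $C_i=\mathrm{id}$, is linear-spanning on every $(f_i)\in\mathcal F^\Delta_{L,\mu}$, for every $\Delta$, and satisfies $\mathrm{TCC}_\epsilon\le K\,r\,d\,\sqrt\kappa\,\ln\frac{\mu\Delta}{\epsilon}$ for all $0<\epsilon\le c_0\mu\Delta$ and $r\ge1$; likewise for all $n\ge1$, $d$ and $L>0$ there is one that is linear-spanning on every $(f_i)\in\mathcal F^\Delta_{L,0}$ and satisfies $\mathrm{TCC}_\epsilon\le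 K\,r\,d\,\sqrt{L\Delta/\epsilon}$ for all $0<\epsilon\le c_0L\Delta$ and $r\ge1$. -/

import Mathlib

open MeasureTheory
open scoped ENNReal

universe u v

noncomputable section

namespace DistOpt

/-- The space `ℝ^d` with its Euclidean norm. -/
abbrev E (d : ℕ) : Type := EuclideanSpace ℝ (Fin d)

/-! ### The optimization problem -/

/-- The global objective `f = (1/n) ∑ f_i`. -/
def avg {n d : ℕ} (f : Fin n → E d → ℝ) (x : E d) : ℝ :=
  (1 / (n : ℝ)) * ∑ i, f i x

/-- The function class `F_{L,μ}^Δ` for the starting point `x⁰ = 0`: every local function is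
differentiable, `L`-smooth and `μ`-strongly convex, and some global minimizer `x⋆` of the average
satisfies `‖x⁰ - x⋆‖² ≤ Δ`. -/
structure InClass {n d : ℕ} (L μ Δ : ℝ) (f : Fin n → E d → ℝ) : Prop where
  differentiable : ∀ i, Differentiable ℝ (f i)
  strong_convex : ∀ i (x y : E d),
    μ / 2 * ‖y - x‖ ^ 2 ≤ f i y - f i x - inner ℝ (gradient (f i) x) (y - x)
  smooth : ∀ i (x y : E d),
    f i y - f i x - inner ℝ (gradient (f i) x) (y - x) ≤ L / 2 * ‖y - x‖ ^ 2
  minimizer : ∃ xs : E d, (∀ y, avg f xs ≤ avg f y) ∧ ‖(0 : E d) - xs‖ ^ 2 ≤ Δ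

/-! ### Compressors -/

/-- A family of `n` random compressors `C_i : ℝ^d → ℝ^d`. In each communication round one seed is
drawn from `law` and used by all the workers, so that the joint law of the compressors of the
different workers within a round is arbitrary (identical, independent, or anything else). -/
structure CompressorFamily (n d : ℕ) where
  Seed : Type u
  [measurableSpace : MeasurableSpace Seed]
  law : Measure Seed
  [isProbabilityMeasure : IsProbabilityMeasure law]
  compress : Fin n → Seed → E d → E d
  measurable_compress : ∀ i, Measurable fun p : Seed × E d => compress i p.1 p.2

attribute [instance] CompressorFamily.measurableSpace CompressorFamily.isProbabilityMeasure

namespace CompressorFamily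

variable {n d : ℕ}

/-- All the compressors of the family are `ω`-unbiased: `𝔼[C_i(x)] = x` and
`𝔼[‖C_i(x) - x‖²] ≤ ω ‖x‖²` for all `x`. No independence is required. -/
def IsUnbiased (ω : ℝ) (C : CompressorFamily.{u} n d) : Prop :=
  ∀ (i : Fin n) (x : E d),
    Integrable (fun s => C.compress i s x) C.law ∧
    ∫ s, C.compress i s x ∂C.law = x ∧
    Integrable (fun s => ‖C.compress i s x - x‖ ^ 2) C.law ∧
    ∫ s, ‖C.compress i s x - x‖ ^ 2 ∂C.law ≤ ω * ‖x‖ ^ 2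

/-- At a precision of `r` bits per entry (for numbers in `[-1, 1]`: errors of at most `2^{-r}` in
an entry are ignored), the messages `C_i(x)` can be encoded by words of `b` bits: a
fixed decoder recovers from some `b`-bit word, up to an error of `2^{-r}` in each entry, whatever
`C_i` outputs on any input with entries in `[-1, 1]`. -/
def EncodableIn (C : CompressorFamily.{u} n d) (r : ℕ) (i : Fin n) (b : ℕ) : Prop :=
  ∃ decode : (Fin b → Bool) → E d, ∀ x : E d, (∀ k, |x k| ≤ 1) →
    ∀ᵐ s ∂C.law, ∃ w, ∀ k, |decode w k - C.compress i s x k| ≤ (2 : ℝ)⁻¹ ^ r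

/-- The number of bits that worker `i` sends per round, at a precision of `r` bits per entry
(`⊤` if no finite number suffices). -/
def bitCost (C : CompressorFamily.{u} n d) (r : ℕ) (i : Fin n) : ℕ∞ :=
  ⨅ (b : ℕ) (_ : C.EncodableIn r i b), (b : ℕ∞)

/-- The per-round communication cost of the family, per worker. (It is meant for families whose
members all have the same cost; in general, it is the largest of the costs.) -/
def perRoundCost (C : CompressorFamily.{u} n d) (r : ℕ) : ℕ∞ :=
  ⨆ i, C.bitCost r i

end CompressorFamily

/-- No compression: every `C_i` is the identity. -/
def noCompression (n d : ℕ) : CompressorFamily.{0} n d where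
  Seed := Unit
  law := Measure.dirac ()
  compress := fun _ _ x => x
  measurable_compress := fun _ => measurable_snd

/-! ### Algorithms -/

/-- A centralized, synchronous, possibly randomized algorithm for `n` workers and one server, with
compression of the messages from the workers to the server. Rounds are numbered `0, 1, 2, …`.
`Coin` holds the internal randomness of the algorithm.
* `broadcast t` is the vector that the server sends at the start of round `t`; it depends on the
  messages received in the rounds `< t`.
* `query i t` is the set of vectors at which worker `i`, which has the local function `f_i`,
  evaluates its gradient in round `t`, and `message i t` is the vector that it then wants to send
  (before compression); they depend on the vectors broadcast in the rounds `≤ t` and on its own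
  compressed messages of the rounds `< t`.
* `output t` is the model that the server outputs after `t` rounds. -/
structure Algorithm (n d : ℕ) where
  Coin : Type v
  [measurableSpace : MeasurableSpace Coin]
  coinLaw : Measure Coin
  [isProbabilityMeasure : IsProbabilityMeasure coinLaw]
  broadcast : (t : ℕ) → Coin → (Fin t → Fin n → E d) → E d
  query : (i : Fin n) → (t : ℕ) → Coin → (E d → ℝ) → (Fin (t + 1) → E d) → (Fin t → E d) →
    Set (E d)
  message : (i : Fin n) → (t : ℕ) → Coin → (E d → ℝ) → (Fin (t + 1) → E d) → (Fin t → E d) → E d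
  output : (t : ℕ) → Coin → (Fin t → Fin n → E d) → E d
  measurable_broadcast : ∀ t,
    Measurable fun p : Coin × (Fin t → Fin n → E d) => broadcast t p.1 p.2
  measurable_message : ∀ i t (φ : E d → ℝ),
    Measurable fun p : Coin × (Fin (t + 1) → E d) × (Fin t → E d) =>
      message i t p.1 φ p.2.1 p.2.2
  measurable_output : ∀ t,
    Measurable fun p : Coin × (Fin t → Fin n → E d) => output t p.1 p.2

attribute [instance] Algorithm.measurableSpace Algorithm.isProbabilityMeasure

namespace Algorithm

variable {n d : ℕ}

/-- The compressed message `C_i(v_i^t)` that the server receives from worker `i` in round `t`, when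
the algorithm runs on `(f, C)` with coin `c` and with the compressor seed `ξ t` in round `t`. -/
def recv (A : Algorithm.{v} n d) (f : Fin n → E d → ℝ) (C : CompressorFamily.{u} n d)
    (c : A.Coin) (ξ : ℕ → C.Seed) (t : ℕ) (i : Fin n) : E d :=
  C.compress i (ξ t)
    (A.message i t c (f i)
      (fun s : Fin (t + 1) =>
        A.broadcast s c (fun (r : Fin s) (j : Fin n) => recv A f C c ξ r j))
      (fun s : Fin t => recv A f C c ξ s i))
termination_by t
decreasing_by
  · have _h1 := r.isLt
    have _h2 := s.isLt
    omega
  · exact s.isLt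

section Run

variable (A : Algorithm.{v} n d) (f : Fin n → E d → ℝ) (C : CompressorFamily.{u} n d)
  (c : A.Coin) (ξ : ℕ → C.Seed)

/-- The vector `u^t` broadcast by the server in round `t`. -/
def sent (t : ℕ) : E d :=
  A.broadcast t c (fun (r : Fin t) (j : Fin n) => A.recv f C c ξ r j)

/-- The set `Y_i^t` of gradient queries of worker `i` in round `t`. -/
def queries (t : ℕ) (i : Fin n) : Set (E d) :=
  A.query i t c (f i) (fun s : Fin (t + 1) => A.sent f C c ξ s)
    (fun s : Fin t => A.recv f C c ξ s i)

/-- The vector `v_i^t` that worker `i` sends in round `t`, before compression. -/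
def msg (t : ℕ) (i : Fin n) : E d :=
  A.message i t c (f i) (fun s : Fin (t + 1) => A.sent f C c ξ s)
    (fun s : Fin t => A.recv f C c ξ s i)

/-- The output of the server after `t` communication rounds. -/
def out (t : ℕ) : E d :=
  A.output t c (fun (r : Fin t) (j : Fin n) => A.recv f C c ξ r j)

end Run

/-- The algorithm is linear-spanning on the instance `(f, C)`. -/
structure LinearSpanning (A : Algorithm.{v} n d) (f : Fin n → E d → ℝ)
    (C : CompressorFamily.{u} n d) : Prop where
  sent_mem : ∀ c ξ t, A.sent f C c ξ t ∈ Submodule.span ℝ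
    ({x | ∃ r < t, x = A.sent f C c ξ r} ∪ {x | ∃ r < t, ∃ i, x = A.recv f C c ξ r i})
  queries_subset : ∀ c ξ t i, A.queries f C c ξ t i ⊆ Submodule.span ℝ
    ({x | ∃ r ≤ t, x = A.sent f C c ξ r} ∪
      {x | ∃ r < t, ∃ y ∈ A.queries f C c ξ r i, x = gradient (f i) y} ∪
      {x | ∃ r < t, x = A.recv f C c ξ r i})
  msg_mem : ∀ c ξ t i, A.msg f C c ξ t i ∈ Submodule.span ℝ
    ({x | ∃ r ≤ t, x = A.sent f C c ξ r} ∪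
      {x | ∃ r ≤ t, ∃ y ∈ A.queries f C c ξ r i, x = gradient (f i) y} ∪
      {x | ∃ r < t, x = A.recv f C c ξ r i})
  out_mem : ∀ c ξ t, A.out f C c ξ t ∈ Submodule.span ℝ
    ({x | ∃ r < t, x = A.sent f C c ξ r} ∪ {x | ∃ r < t, ∃ i, x = A.recv f C c ξ r i})

/-- The expected suboptimality `𝔼[f(x̂^t)] - min f` after `t` rounds. The seeds of the different
rounds are independent with law `C.law`, and independent of the coin of the algorithm. -/
def expectedGap (A : Algorithm.{v} n d) (f : Fin n → E d → ℝ) (C : CompressorFamily.{u} n d)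
    (t : ℕ) : ℝ≥0∞ :=
  ∫⁻ p, ENNReal.ofReal (avg f (A.out f C p.1 p.2 t) - ⨅ x, avg f x)
    ∂(A.coinLaw.prod (Measure.infinitePi fun _ : ℕ => C.law))

/-- The convergence complexity `T_ε`: the least number of rounds after which the expected
suboptimality is at most `ε` (`⊤` if there is none). -/
def rounds (A : Algorithm.{v} n d) (f : Fin n → E d → ℝ) (C : CompressorFamily.{u} n d)
    (ε : ℝ) : ℕ∞ :=
  ⨅ (t : ℕ) (_ : A.expectedGap f C t ≤ ENNReal.ofReal ε), (t : ℕ∞)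

/-- The total communication cost `TCC_ε` (in bits, per worker), at a precision of `r` bits per
entry: the per-round cost times the number of rounds. -/
def tcc (A : Algorithm.{v} n d) (f : Fin n → E d → ℝ) (C : CompressorFamily.{u} n d)
    (r : ℕ) (ε : ℝ) : ℝ≥0∞ :=
  (C.perRoundCost r : ℝ≥0∞) * (A.rounds f C ε : ℝ≥0∞)

end Algorithm

end DistOpt

end

/-!
Bit costs. On the sign vectors, an `ω`-unbiased compressor produces vectors of squared norm at most
`(1 + ω) d` whose correlation with the input is `d` on average, so some codeword correlates with
each of the `2 ^ d` sign vectors; the exponential moments of a random sign vector show that this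
takes `exp (c d / (1 + ω))` codewords.

Rounds. The hard objective is a quadratic on a chain of coordinates whose links of even and odd
index are held by different workers, so that no worker can extend the known prefix twice without
hearing from the others. All the workers keep the same random residue class of coordinates modulo
`m ≈ 1 + ω`, hence a new coordinate gets through with probability `1 / m` in each round. If the best
accuracy on a prefix of length `k` is of order `φ ^ k`, the expected accuracy after `t` rounds is of
order at least `(1 - (1 - φ) / m) ^ t`. The generally convex case is the strongly convex one with
`μ` proportional to `ε / Δ`. In the product of the two bounds the factor `1 + ω` cancels.

Attainment. With exact gradients the method is Nesterov's, analysed by a Lyapunov function.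
-/

noncomputable section

namespace DistOpt

/-! ### Lower bound on bit costs -/

/-- The vector with entries `±1` prescribed by a word of signs, `true` standing for `1`. These are
the inputs on which an unbiased compressor is shown to need many bits. -/
def signVec {d : ℕ} (σ : Fin d → Bool) : E d :=
  WithLp.toLp 2 fun k => if σ k then 1 else -1

theorem abs_signVec_apply {d : ℕ} (σ : Fin d → Bool) (k : Fin d) : |signVec σ k| = 1 := by
  simp only [signVec]
  split <;> norm_num

theorem norm_signVec_sq {d : ℕ} (σ : Fin d → Bool) : ‖signVec σ‖ ^ 2 = (d : ℝ) := by
  simp [EuclideanSpace.real_norm_sq_eq, ← sq_abs (signVec σ _), abs_signVec_apply]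

theorem sum_exp_inner_signVec {d : ℕ} (y : E d) :
    ∑ σ : Fin d → Bool, Real.exp (inner ℝ y (signVec σ)) = ∏ k, (2 * Real.cosh (y k)) := by
  have hfactor (k : Fin d) :
      2 * Real.cosh (y k) = ∑ b : Bool, Real.exp ((if b then 1 else -1) * y k) := by
    simp [Real.cosh_eq, mul_div_cancel₀]
  simp_rw [hfactor, Finset.prod_univ_sum, Fintype.piFinset_univ, ← Real.exp_sum]
  simp [PiLp.inner_apply, signVec]

theorem sum_exp_inner_signVec_le {d : ℕ} (y : E d) :
    ∑ σ : Fin d → Bool, Real.exp (inner ℝ y (signVec σ)) ≤ 2 ^ d * Real.exp (‖y‖ ^ 2 / 2) := by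
  calc ∑ σ : Fin d → Bool, Real.exp (inner ℝ y (signVec σ))
      = ∏ k, (2 * Real.cosh (y k)) := sum_exp_inner_signVec y
    _ ≤ ∏ k, (2 * Real.exp (y k ^ 2 / 2)) :=
        Finset.prod_le_prod (fun k _ => mul_nonneg zero_le_two (Real.cosh_pos _).le)
          fun k _ => mul_le_mul_of_nonneg_left (Real.cosh_le_exp_half_sq _) zero_le_two
    _ = 2 ^ d * Real.exp (‖y‖ ^ 2 / 2) := by
        rw [Finset.prod_mul_distrib, ← Real.exp_sum, ← Finset.sum_div,
          EuclideanSpace.real_norm_sq_eq]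
        simp

theorem exp_le_card_of_forall_signVec {d : ℕ} {W : Type*} [Fintype W] (y : W → E d) {a : ℝ}
    (h : ∀ σ : Fin d → Bool, ∃ w, a ≤ inner ℝ (y w) (signVec σ) - ‖y w‖ ^ 2 / 2) :
    Real.exp a ≤ Fintype.card W := by
  have hσ (σ : Fin d → Bool) :
      Real.exp a ≤ ∑ w, Real.exp (inner ℝ (y w) (signVec σ)) * Real.exp (-(‖y w‖ ^ 2 / 2)) := by
    obtain ⟨w, hw⟩ := h σ
    simp_rw [← Real.exp_add, ← sub_eq_add_neg]
    exact (Real.exp_le_exp.mpr hw).trans <| Finset.single_le_sum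
      (f := fun w => Real.exp (inner ℝ (y w) (signVec σ) - ‖y w‖ ^ 2 / 2))
      (fun _ _ => (Real.exp_pos _).le) (Finset.mem_univ w)
  have hw (w : W) : (∑ σ : Fin d → Bool, Real.exp (inner ℝ (y w) (signVec σ))) *
      Real.exp (-(‖y w‖ ^ 2 / 2)) ≤ 2 ^ d := by
    rw [Real.exp_neg, ← div_eq_mul_inv, div_le_iff₀ (Real.exp_pos _)]
    exact sum_exp_inner_signVec_le (y w)
  refine le_of_mul_le_mul_left ?_ (show (0 : ℝ) < 2 ^ d by positivity)
  calc 2 ^ d * Real.exp a = ∑ _σ : Fin d → Bool, Real.exp a := by simp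
    _ ≤ ∑ σ : Fin d → Bool, ∑ w,
          Real.exp (inner ℝ (y w) (signVec σ)) * Real.exp (-(‖y w‖ ^ 2 / 2)) :=
        Finset.sum_le_sum fun σ _ => hσ σ
    _ = ∑ w, (∑ σ : Fin d → Bool, Real.exp (inner ℝ (y w) (signVec σ))) *
          Real.exp (-(‖y w‖ ^ 2 / 2)) := by
        rw [Finset.sum_comm]
        simp_rw [Finset.sum_mul]
    _ ≤ ∑ _w : W, (2 : ℝ) ^ d := Finset.sum_le_sum fun w _ => hw w
    _ = 2 ^ d * Fintype.card W := by simp [mul_comm]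

theorem norm_sq_le_of_forall_abs_le {d : ℕ} {v : E d} {δ : ℝ} (h : ∀ k, |v k| ≤ δ) :
    ‖v‖ ^ 2 ≤ d * δ ^ 2 := by
  rw [EuclideanSpace.real_norm_sq_eq]
  calc ∑ k, v k ^ 2 ≤ ∑ _k : Fin d, δ ^ 2 :=
        Finset.sum_le_sum fun k _ => sq_le_sq' (abs_le.mp (h k)).1 (abs_le.mp (h k)).2
    _ = d * δ ^ 2 := by simp

theorem inner_sub_mul_norm_sq_le_of_two_mul_norm_sub_le {F : Type*} [NormedAddCommGroup F]
    [InnerProductSpace ℝ F] {x y z : F} {lam : ℝ} (hlam : 0 ≤ lam)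
    (h : 2 * ‖z - y‖ ≤ ‖x‖) :
    inner ℝ y x - 2 * lam * ‖y‖ ^ 2 - (1 + lam) / 2 * ‖x‖ ^ 2 ≤
      inner ℝ z x - lam * ‖z‖ ^ 2 := by
  have hinner : inner ℝ y x - ‖x‖ ^ 2 / 2 ≤ inner ℝ z x := by
    have hcs := (abs_le.mp (abs_real_inner_le_norm (z - y) x)).1
    rw [inner_sub_left] at hcs
    nlinarith [norm_nonneg x]
  have hnorm : ‖z‖ ^ 2 ≤ 2 * ‖y‖ ^ 2 + ‖x‖ ^ 2 / 2 := by
    have hpar := parallelogram_law_with_norm ℝ y (z - y)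
    rw [add_sub_cancel] at hpar
    nlinarith [norm_nonneg (z - y), sq_nonneg ‖y - (z - y)‖]
  nlinarith

theorem norm_sq_eq_norm_sub_sq {F : Type*} [NormedAddCommGroup F] [InnerProductSpace ℝ F]
    (x y : F) : ‖y‖ ^ 2 = ‖y - x‖ ^ 2 + 2 * inner ℝ y x - ‖x‖ ^ 2 := by
  rw [norm_sub_sq_real]
  ring

namespace CompressorFamily

variable {n d : ℕ} {ω : ℝ} {C : CompressorFamily.{u} n d}

theorem IsUnbiased.integral_inner (hC : C.IsUnbiased ω) (i : Fin n) (x : E d) :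
    ∫ s, inner ℝ (C.compress i s x) x ∂C.law = ‖x‖ ^ 2 := by
  obtain ⟨hint, hmean, -, -⟩ := hC i x
  simp_rw [real_inner_comm x]
  rw [_root_.integral_inner hint, hmean, real_inner_self_eq_norm_sq]

theorem IsUnbiased.integrable_norm_sq (hC : C.IsUnbiased ω) (i : Fin n) (x : E d) :
    Integrable (fun s => ‖C.compress i s x‖ ^ 2) C.law := by
  obtain ⟨hint, -, hvar, -⟩ := hC i x
  simp_rw [fun s => norm_sq_eq_norm_sub_sq x (C.compress i s x)]
  exact (hvar.add ((hint.inner_const x).const_mul 2)).sub (integrable_const _)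

theorem IsUnbiased.integral_norm_sq_le (hC : C.IsUnbiased ω) (i : Fin n) (x : E d) :
    ∫ s, ‖C.compress i s x‖ ^ 2 ∂C.law ≤ (1 + ω) * ‖x‖ ^ 2 := by
  obtain ⟨hint, -, hvar, hω⟩ := hC i x
  have hinner := (hint.inner_const (𝕜 := ℝ) x).const_mul 2
  have hadd : Integrable (fun s => ‖C.compress i s x - x‖ ^ 2 +
      2 * inner ℝ (C.compress i s x) x) C.law := hvar.add hinner
  simp_rw [fun s => norm_sq_eq_norm_sub_sq x (C.compress i s x)]
  rw [integral_sub hadd (integrable_const _), integral_add hvar hinner,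
    integral_const_mul, hC.integral_inner]
  simp only [integral_const, probReal_univ, one_smul]
  linarith

theorem IsUnbiased.exists_le_inner_sub_mul_norm_sq (hC : C.IsUnbiased ω) (i : Fin n) (x : E d)
    {lam : ℝ} (hlam : 0 ≤ lam) {P : C.Seed → Prop} (hP : ∀ᵐ s ∂C.law, P s) :
    ∃ s, P s ∧ (1 - lam * (1 + ω)) * ‖x‖ ^ 2 ≤
      inner ℝ (C.compress i s x) x - lam * ‖C.compress i s x‖ ^ 2 := by
  have hinner : Integrable (fun s => inner ℝ (C.compress i s x) x) C.law :=
    (hC i x).1.inner_const x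
  have hnorm := (hC.integrable_norm_sq i x).const_mul lam
  obtain ⟨s, hs, hle⟩ := exists_notMem_null_integral_le (hinner.sub hnorm) (ae_iff.mp hP)
  refine ⟨s, not_not.mp hs, le_trans ?_ hle⟩
  have hsub : ∫ s, (inner ℝ (C.compress i s x) x - lam * ‖C.compress i s x‖ ^ 2) ∂C.law =
      ‖x‖ ^ 2 - lam * ∫ s, ‖C.compress i s x‖ ^ 2 ∂C.law := by
    rw [integral_sub hinner hnorm, integral_const_mul, hC.integral_inner]
  refine le_of_le_of_eq ?_ hsub.symm
  linarith [mul_le_mul_of_nonneg_left (hC.integral_norm_sq_le i x) hlam]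

theorem IsUnbiased.exists_codeword_le_inner_sub_mul_norm_sq (hC : C.IsUnbiased ω) (hω : 0 ≤ ω)
    {r : ℕ} (hr : 1 ≤ r) (i : Fin n) {W : Type*} {decode : W → E d}
    (hdecode : ∀ x : E d, (∀ k, |x k| ≤ 1) →
      ∀ᵐ s ∂C.law, ∃ w, ∀ k, |decode w k - C.compress i s x k| ≤ (2 : ℝ)⁻¹ ^ r)
    (σ : Fin d → Bool) :
    ∃ w, 3 / 16 * d ≤
      inner ℝ (decode w) (signVec σ) - 1 / (8 * (1 + ω)) * ‖decode w‖ ^ 2 := by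
  set lam : ℝ := 1 / (8 * (1 + ω)) with hlam_def
  have hlam : 0 < lam := by positivity
  have hlamω : lam * (1 + ω) = 1 / 8 := by rw [hlam_def]; field_simp
  have hlam_le : lam ≤ 1 / 8 := by nlinarith
  obtain ⟨s, ⟨w, hw⟩, hs⟩ := hC.exists_le_inner_sub_mul_norm_sq i (signVec σ)
    (lam := 2 * lam) (by positivity) (hdecode _ fun k => (abs_signVec_apply σ k).le)
  have hclose : 2 * ‖decode w - C.compress i s (signVec σ)‖ ≤ ‖signVec σ‖ := by
    refine (sq_le_sq₀ (by positivity) (norm_nonneg _)).mp ?_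
    have hhalf : (2 : ℝ)⁻¹ ^ r ≤ 1 / 2 := by
      simpa using pow_le_pow_of_le_one (a := (2 : ℝ)⁻¹) (by norm_num) (by norm_num) hr
    have hsq := norm_sq_le_of_forall_abs_le (v := decode w - C.compress i s (signVec σ))
      fun k => (hw k).trans hhalf
    rw [norm_signVec_sq, mul_pow]
    linarith
  refine ⟨w, le_trans ?_ (inner_sub_mul_norm_sq_le_of_two_mul_norm_sub_le hlam.le hclose)⟩
  rw [mul_assoc 2 lam, hlamω, norm_signVec_sq] at hs
  rw [norm_signVec_sq]
  nlinarith [Nat.cast_nonneg (α := ℝ) d]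

theorem IsUnbiased.le_of_encodableIn (hC : C.IsUnbiased ω) (hω : 0 ≤ ω) {r b : ℕ} (hr : 1 ≤ r)
    {i : Fin n} (henc : C.EncodableIn r i b) : 3 / 64 * ((d : ℝ) / (1 + ω)) ≤ b := by
  obtain ⟨decode, hdecode⟩ := henc
  set lam : ℝ := 1 / (8 * (1 + ω)) with hlam_def
  have hlam : 0 < lam := by positivity
  -- For `y = 2 λ z`, `⟪y, x⟫ - ‖y‖² / 2` is `2 λ` times the correlation bounded above.
  have hexp := exp_le_card_of_forall_signVec (fun w => (2 * lam) • decode w)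
    (a := 2 * lam * (3 / 16 * d)) fun σ => by
      obtain ⟨w, hw⟩ := hC.exists_codeword_le_inner_sub_mul_norm_sq hω hr i hdecode σ
      refine ⟨w, (mul_le_mul_of_nonneg_left hw (mul_pos two_pos hlam).le).trans_eq ?_⟩
      rw [real_inner_smul_left, norm_smul, mul_pow, Real.norm_eq_abs, sq_abs]
      ring
  have hlog : 2 * lam * (3 / 16 * d) ≤ b * Real.log 2 := by
    have hle := Real.log_le_log (Real.exp_pos _) hexp
    simpa [Real.log_exp] using hle
  calc 3 / 64 * ((d : ℝ) / (1 + ω)) = 2 * lam * (3 / 16 * d) := by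
        rw [hlam_def]; field_simp; ring
    _ ≤ b * Real.log 2 := hlog
    _ ≤ b := mul_le_of_le_one_right (Nat.cast_nonneg b)
        (Real.log_two_lt_d9.le.trans (by norm_num))

end CompressorFamily

theorem ofReal_le_iInf_natCast {p : ℕ → Prop} {B : ℝ} (h : ∀ t, p t → B ≤ t) :
    ENNReal.ofReal B ≤ ((⨅ (t : ℕ) (_ : p t), (t : ℕ∞) : ℕ∞) : ℝ≥0∞) := by
  have hceil : ((⌈B⌉₊ : ℕ) : ℕ∞) ≤ ⨅ (t : ℕ) (_ : p t), (t : ℕ∞) :=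
    le_iInf₂ fun t ht => by exact_mod_cast Nat.ceil_le.mpr (h t ht)
  calc ENNReal.ofReal B ≤ ENNReal.ofReal (⌈B⌉₊ : ℕ) :=
        ENNReal.ofReal_le_ofReal (Nat.le_ceil B)
    _ = (((⌈B⌉₊ : ℕ) : ℕ∞) : ℝ≥0∞) := by simp
    _ ≤ _ := by exact_mod_cast hceil

theorem CompressorFamily.IsUnbiased.le_bitCost {n d r : ℕ} {ω : ℝ}
    {C : CompressorFamily.{u} n d} (hC : C.IsUnbiased ω) (hω : 0 ≤ ω) (hr : 1 ≤ r) (i : Fin n) :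
    ENNReal.ofReal (3 / 64 * (d / (1 + ω))) ≤ (C.bitCost r i : ℝ≥0∞) :=
  ofReal_le_iInf_natCast fun _ => hC.le_of_encodableIn hω hr

/-! ### Upper bounds on bit costs -/

/-- The midpoint of the `q`-th of the `M * 2 ^ r` intervals of length `2 * 2 ^ (-r)` that partition
`[-M, M]`, counted from `0`; the value that the word `q` stands for at precision `r`. -/
def dequantize (M r q : ℕ) : ℝ := (2 * q + 1) * (2 : ℝ)⁻¹ ^ r - M

theorem exists_abs_dequantize_sub_le {M r : ℕ} (hM : 1 ≤ M) {y : ℝ} (hy : |y| ≤ M) :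
    ∃ q < M * 2 ^ r, |dequantize M r q - y| ≤ (2 : ℝ)⁻¹ ^ r := by
  obtain ⟨hy_ge, hy_le⟩ := abs_le.mp hy
  set z : ℝ := (y + M) * 2 ^ r / 2 with hz
  have hz_nonneg : 0 ≤ z := div_nonneg (mul_nonneg (by linarith) (by positivity)) zero_le_two
  have hceil : ⌈z⌉₊ ≤ M * 2 ^ r := by
    rw [Nat.ceil_le, hz]
    push_cast
    nlinarith [show (0 : ℝ) < 2 ^ r by positivity]
  refine ⟨⌈z⌉₊ - 1, by have : 0 < M * 2 ^ r := by positivity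
                       omega, ?_⟩
  -- The truncated subtraction is harmless: the index is `0` when `z = 0`.
  have hle : ((⌈z⌉₊ - 1 : ℕ) : ℝ) ≤ z := by
    rcases Nat.eq_zero_or_pos ⌈z⌉₊ with h0 | hpos
    · simpa [h0] using hz_nonneg
    · exact (Nat.lt_ceil.mp (by omega)).le
  have hge : z ≤ (⌈z⌉₊ - 1 : ℕ) + 1 :=
    (Nat.le_ceil z).trans (by exact_mod_cast (by omega : ⌈z⌉₊ ≤ ⌈z⌉₊ - 1 + 1))
  have hdiff : dequantize M r (⌈z⌉₊ - 1) - y =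
      (2 * ((⌈z⌉₊ - 1 : ℕ) - z) + 1) * (2 : ℝ)⁻¹ ^ r := by
    rw [dequantize, hz, inv_pow]
    field_simp
    ring
  rw [hdiff, abs_mul, abs_of_pos (a := (2 : ℝ)⁻¹ ^ r) (by positivity)]
  exact mul_le_of_le_one_left (by positivity) (abs_le.mpr ⟨by linarith, by linarith⟩)

namespace CompressorFamily

variable {n d : ℕ} {C : CompressorFamily.{u} n d} {r b : ℕ}

theorem encodableIn_of_card_le {i : Fin n} {W : Type*} [Fintype W]
    (hW : Fintype.card W ≤ 2 ^ b) (decode : W → E d)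
    (h : ∀ x : E d, (∀ k, |x k| ≤ 1) →
      ∀ᵐ s ∂C.law, ∃ w, ∀ k, |decode w k - C.compress i s x k| ≤ (2 : ℝ)⁻¹ ^ r) :
    C.EncodableIn r i b := by
  obtain ⟨e⟩ : Nonempty (W ↪ (Fin b → Bool)) :=
    Function.Embedding.nonempty_of_card_le (by simpa using hW)
  refine ⟨Function.extend e decode 0, fun x hx => ?_⟩
  filter_upwards [h x hx] with s ⟨w, hw⟩
  exact ⟨e w, by rwa [e.injective.extend_apply]⟩

theorem perRoundCost_le (h : ∀ i, C.EncodableIn r i b) : C.perRoundCost r ≤ b :=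
  iSup_le fun i => iInf₂_le b (h i)

end CompressorFamily

theorem perRoundCost_noCompression_le (n d r : ℕ) :
    (noCompression n d).perRoundCost r ≤ (r * d : ℕ) := by
  refine CompressorFamily.perRoundCost_le fun i =>
    CompressorFamily.encodableIn_of_card_le (W := Fin d → Fin (1 * 2 ^ r)) (by simp [pow_mul])
      (fun w => WithLp.toLp 2 fun k => dequantize 1 r (w k)) fun x hx =>
        Filter.Eventually.of_forall fun _ => ?_
  choose q hq hqx using fun k =>
    exists_abs_dequantize_sub_le (r := r) le_rfl (y := x k) (by simpa using hx k)
  exact ⟨fun k => ⟨q k, hq k⟩, hqx⟩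

theorem isUnbiased_noCompression (n d : ℕ) {ω : ℝ} (hω : 0 ≤ ω) :
    (noCompression n d).IsUnbiased ω := by
  intro i x
  refine ⟨integrable_const x, integral_dirac (fun _ : Unit => x) (), integrable_const (‖x - x‖ ^ 2),
    (integral_dirac (fun _ : Unit => ‖x - x‖ ^ 2) ()).le.trans ?_⟩
  rw [sub_self, norm_zero, zero_pow two_ne_zero]
  positivity

/-! ### Random sparsification with a shared seed -/

/-- The sparsification of `x` that keeps the coordinates in the residue class `s` modulo `m`, scaled
by `m` so that the average over `s` is `x`. -/
def keepClass {d m : ℕ} (s : Fin m) (x : E d) : E d :=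
  WithLp.toLp 2 fun k => if (k : ℕ) % m = s then m * x k else 0

/-- The compressors of the hard instances: all the workers keep the coordinates in the same residue
class modulo `m`, which is drawn uniformly at random. -/
def classSparsifier (n d m : ℕ) [NeZero m] : CompressorFamily.{0} n d where
  Seed := Fin m
  law := (PMF.uniformOfFintype (Fin m)).toMeasure
  compress := fun _ s x => keepClass s x
  measurable_compress := fun _ => by
    refine measurable_from_prod_countable_right fun s => ?_
    refine (WithLp.measurable_toLp 2 _).comp (measurable_pi_lambda _ fun k => ?_)
    dsimp only
    split_ifs <;> fun_prop

theorem integral_uniformOfFintype {α F : Type*} [Fintype α] [Nonempty α] [MeasurableSpace α]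
    [MeasurableSingletonClass α] [NormedAddCommGroup F] [NormedSpace ℝ F] [CompleteSpace F]
    (g : α → F) :
    ∫ s, g s ∂(PMF.uniformOfFintype α).toMeasure = (Fintype.card α : ℝ)⁻¹ • ∑ s, g s := by
  rw [PMF.integral_eq_sum, Finset.smul_sum]
  simp

theorem norm_keepClass_sub_sq {d m : ℕ} (s : Fin m) (x : E d) :
    ‖keepClass s x - x‖ ^ 2 =
      ∑ k : Fin d, (if (k : ℕ) % m = s then m * (m - 2) * x k ^ 2 else 0) + ‖x‖ ^ 2 := by
  rw [EuclideanSpace.real_norm_sq_eq, EuclideanSpace.real_norm_sq_eq, ← Finset.sum_add_distrib]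
  refine Finset.sum_congr rfl fun k _ => ?_
  simp only [PiLp.sub_apply, keepClass]
  split_ifs <;> ring

section Sparsifier

variable {n d m : ℕ} [NeZero m]

theorem sum_ite_mod_eq {F : Type*} [AddCommMonoid F] (k : ℕ) (a : F) :
    ∑ s : Fin m, (if k % m = s then a else 0) = a := by
  have hmod (s : Fin m) : k % m = s ↔ (⟨k % m, Nat.mod_lt k (Nat.pos_of_neZero m)⟩ : Fin m) = s :=
    ⟨fun h => Fin.ext h, congrArg Fin.val⟩
  simp_rw [hmod, Finset.sum_ite_eq, Finset.mem_univ, if_true]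

theorem integral_keepClass (x : E d) :
    ∫ s : Fin m, keepClass s x ∂(PMF.uniformOfFintype (Fin m)).toMeasure = x := by
  rw [integral_uniformOfFintype]
  ext k
  simp only [PiLp.smul_apply, WithLp.ofLp_sum, Finset.sum_apply, keepClass, sum_ite_mod_eq]
  simp [NeZero.ne m]

theorem integral_norm_keepClass_sub_sq (x : E d) :
    ∫ s : Fin m, ‖keepClass s x - x‖ ^ 2 ∂(PMF.uniformOfFintype (Fin m)).toMeasure =
      (m - 1) * ‖x‖ ^ 2 := by
  have hm : (m : ℝ) ≠ 0 := NeZero.ne _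
  simp_rw [integral_uniformOfFintype, norm_keepClass_sub_sq, Finset.sum_add_distrib]
  rw [Finset.sum_comm]
  simp_rw [sum_ite_mod_eq, ← Finset.mul_sum, ← EuclideanSpace.real_norm_sq_eq]
  simp only [Fintype.card_fin, Finset.sum_const, Finset.card_univ, nsmul_eq_mul, smul_eq_mul]
  field_simp
  ring

theorem isUnbiased_classSparsifier {ω : ℝ} (hm : (m : ℝ) ≤ 1 + ω) :
    (classSparsifier n d m).IsUnbiased ω := by
  refine fun i x => ⟨Integrable.of_finite (μ := (PMF.uniformOfFintype (Fin m)).toMeasure),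
    integral_keepClass x, Integrable.of_finite (μ := (PMF.uniformOfFintype (Fin m)).toMeasure),
    (integral_norm_keepClass_sub_sq x).le.trans ?_⟩
  gcongr
  linarith

/-- The decoder of `classSparsifier`: a codeword consists of the residue class and of one grid point
per coordinate of that class, the coordinate `k` being the `(k / m)`-th. -/
def decodeClass {d m r : ℕ} (w : Fin m × (Fin (d / m + 1) → Fin (m * 2 ^ r))) : E d :=
  WithLp.toLp 2 fun k => if (k : ℕ) % m = w.1 then
    dequantize m r (w.2 ⟨k / m, Nat.lt_succ_of_le (Nat.div_le_div_right k.isLt.le)⟩) else 0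

theorem exists_abs_decodeClass_sub_keepClass_le {r : ℕ} (s : Fin m) {x : E d}
    (hx : ∀ k, |x k| ≤ 1) :
    ∃ w : Fin m × (Fin (d / m + 1) → Fin (m * 2 ^ r)),
      ∀ k, |decodeClass w k - keepClass s x k| ≤ (2 : ℝ)⁻¹ ^ r := by
  have hm : 0 < m := Nat.pos_of_neZero m
  have hcode (k : Fin d) : ∃ v < m * 2 ^ r, |dequantize m r v - m * x k| ≤ (2 : ℝ)⁻¹ ^ r :=
    exists_abs_dequantize_sub_le hm (by
      rw [abs_mul, Nat.abs_cast]
      exact mul_le_of_le_one_right (Nat.cast_nonneg _) (hx k))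
  choose v hv hvx using hcode
  refine ⟨(s, fun q => if hq : q * m + s < d then ⟨v ⟨_, hq⟩, hv _⟩ else ⟨0, by positivity⟩),
    fun k => ?_⟩
  simp only [decodeClass, keepClass]
  split_ifs with hk hq
  · simpa only [← hk, Nat.div_add_mod'] using hvx k
  · exact absurd (by rw [← hk, Nat.div_add_mod']; exact k.isLt) hq
  · simp

theorem encodableIn_classSparsifier (n d m r : ℕ) [NeZero m] (i : Fin n) :
    (classSparsifier n d m).EncodableIn r i
      (Nat.clog 2 m + (r + Nat.clog 2 m) * (d / m + 1)) := by
  refine CompressorFamily.encodableIn_of_card_le ?_ decodeClass fun x hx =>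
    Filter.Eventually.of_forall fun s => exists_abs_decodeClass_sub_keepClass_le s hx
  have hclog : m ≤ 2 ^ Nat.clog 2 m := Nat.le_pow_clog one_lt_two m
  simp only [Fintype.card_prod, Fintype.card_fin, Fintype.card_fun]
  rw [pow_add 2 (Nat.clog 2 m), pow_mul 2 (r + Nat.clog 2 m), pow_add 2 r, mul_comm (2 ^ r)]
  gcongr

theorem natCast_clog_two_le (m : ℕ) : (Nat.clog 2 m : ℝ) ≤ Real.logb 2 m + 1 := by
  rcases Nat.eq_zero_or_pos m with rfl | hm
  · simp
  rw [← Real.natCeil_logb_natCast]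
  exact (Nat.ceil_lt_add_one
    (Real.logb_nonneg one_lt_two (by exact_mod_cast hm))).le

theorem perRoundCost_classSparsifier_le {ω : ℝ} {r : ℕ} (hr : 1 ≤ r) (hm : (m : ℝ) ≤ 1 + ω)
    (hm2 : 1 + ω ≤ 2 * m) (hd : m ≤ d) :
    ((classSparsifier n d m).perRoundCost r : ℝ≥0∞) ≤
      ENNReal.ofReal (12 * (d / (1 + ω)) * (r + Real.logb 2 (1 + ω))) := by
  have hm_pos : (0 : ℝ) < m := by exact_mod_cast Nat.pos_of_neZero m
  set ℓ := Nat.clog 2 m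
  have hbits : ((classSparsifier n d m).perRoundCost r : ℝ≥0∞) ≤
      ((ℓ + (r + ℓ) * (d / m + 1) : ℕ) : ℝ≥0∞) := by
    exact_mod_cast ENat.toENNReal_le.mpr
      (CompressorFamily.perRoundCost_le (encodableIn_classSparsifier n d m r))
  refine hbits.trans ?_
  rw [← ENNReal.ofReal_natCast]
  refine ENNReal.ofReal_le_ofReal ?_
  have hlog : (ℓ : ℝ) ≤ Real.logb 2 (1 + ω) + r :=
    (natCast_clog_two_le m).trans (add_le_add
      (Real.logb_le_logb_of_le one_lt_two hm_pos hm) (by exact_mod_cast hr))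
  have hlog_nonneg : 0 ≤ Real.logb 2 (1 + ω) := Real.logb_nonneg one_lt_two
    ((by exact_mod_cast Nat.pos_of_neZero m : (1 : ℝ) ≤ m).trans hm)
  have hdm : (1 : ℝ) ≤ d / m := (one_le_div hm_pos).mpr (by exact_mod_cast hd)
  have hdω : (d : ℝ) / m ≤ 2 * (d / (1 + ω)) := by
    rw [← mul_div_assoc, div_le_div_iff₀ hm_pos (by linarith)]
    nlinarith [Nat.cast_nonneg (α := ℝ) d]
  push_cast
  calc (ℓ : ℝ) + (r + ℓ) * ((d / m : ℕ) + 1)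
      ≤ (r + ℓ) * (d / m) + (r + ℓ) * (d / m + d / m) := by
        gcongr ?_ + _ * (?_ + ?_)
        · nlinarith [Nat.cast_nonneg (α := ℝ) ℓ, Nat.cast_nonneg (α := ℝ) r]
        · exact Nat.cast_div_le
    _ = 3 * ((r + ℓ) * (d / m)) := by ring
    _ ≤ 3 * (2 * (r + Real.logb 2 (1 + ω)) * (2 * (d / (1 + ω)))) := by
        gcongr
        linarith
    _ = 12 * (d / (1 + ω)) * (r + Real.logb 2 (1 + ω)) := by ring

end Sparsifier

/-! ### The accelerated gradient method -/

/-- The square roots of the weights of the accelerated gradient method. For the weights themselves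
the recursion would be implicit. -/
def accWeight (L μ : ℝ) : ℕ → ℝ
  | 0 => 0
  | k + 1 => accWeight L μ k + √((1 + μ * accWeight L μ k ^ 2) / L) / 2

section Weights

variable {L μ : ℝ}

theorem accWeight_nonneg (k : ℕ) : 0 ≤ accWeight L μ k := by
  induction k with
  | zero => exact le_rfl
  | succ k ih => rw [accWeight]; positivity

theorem accWeight_le_succ (k : ℕ) : accWeight L μ k ≤ accWeight L μ (k + 1) :=
  le_add_of_nonneg_right (by positivity)

theorem accWeight_succ_pos (hL : 0 < L) (hμ : 0 ≤ μ) (k : ℕ) : 0 < accWeight L μ (k + 1) :=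
  add_pos_of_nonneg_of_pos (accWeight_nonneg k) (by positivity)

theorem mul_accWeight_sq_sub_sq_le (hL : 0 < L) (hμ : 0 ≤ μ) (k : ℕ) :
    L * (accWeight L μ (k + 1) ^ 2 - accWeight L μ k ^ 2) ^ 2 ≤
      accWeight L μ (k + 1) ^ 2 * (1 + μ * accWeight L μ k ^ 2) := by
  have hw := accWeight_nonneg (L := L) (μ := μ) k
  rw [accWeight]
  set w := accWeight L μ k
  set ρ := √((1 + μ * w ^ 2) / L)
  have hρ : L * ρ ^ 2 = 1 + μ * w ^ 2 := by
    rw [Real.sq_sqrt (by positivity), mul_div_cancel₀ _ hL.ne']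
  have : 0 ≤ ρ := Real.sqrt_nonneg _
  calc L * ((w + ρ / 2) ^ 2 - w ^ 2) ^ 2 = (w + ρ / 4) ^ 2 * (L * ρ ^ 2) := by ring
    _ ≤ (w + ρ / 2) ^ 2 * (L * ρ ^ 2) := by gcongr; norm_num
    _ = (w + ρ / 2) ^ 2 * (1 + μ * w ^ 2) := by rw [hρ]

theorem div_two_mul_sqrt_le_accWeight (hL : 0 < L) (hμ : 0 ≤ μ) (k : ℕ) :
    k / (2 * √L) ≤ accWeight L μ k := by
  induction k with
  | zero => simp [accWeight]
  | succ k ih =>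
    have hstep : 1 / √L ≤ √((1 + μ * accWeight L μ k ^ 2) / L) := by
      rw [Real.sqrt_div' _ hL.le]
      gcongr
      rw [Real.one_le_sqrt]
      exact le_add_of_nonneg_right (by positivity)
    calc ((k + 1 : ℕ) : ℝ) / (2 * √L) = k / (2 * √L) + 1 / √L / 2 := by push_cast; field_simp
      _ ≤ accWeight L μ (k + 1) := by rw [accWeight]; gcongr

theorem accWeight_mul_pow_le (hL : 0 < L) (hμ : 0 ≤ μ) (j k : ℕ) :
    accWeight L μ j * (1 + √(μ / L) / 2) ^ k ≤ accWeight L μ (j + k) := by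
  induction k with
  | zero => simp
  | succ k ih =>
    have hstep : √(μ / L) * accWeight L μ (j + k) ≤
        √((1 + μ * accWeight L μ (j + k) ^ 2) / L) := by
      refine Real.le_sqrt_of_sq_le ?_
      rw [mul_pow, Real.sq_sqrt (by positivity), div_mul_eq_mul_div]
      gcongr
      exact le_add_of_nonneg_left zero_le_one
    calc accWeight L μ j * (1 + √(μ / L) / 2) ^ (k + 1)
        = accWeight L μ j * (1 + √(μ / L) / 2) ^ k * (1 + √(μ / L) / 2) := by ring
      _ ≤ accWeight L μ (j + k) * (1 + √(μ / L) / 2) := by gcongr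
      _ = accWeight L μ (j + k) + √(μ / L) * accWeight L μ (j + k) / 2 := by ring
      _ ≤ accWeight L μ (j + (k + 1)) := by rw [← Nat.add_assoc, accWeight]; gcongr

end Weights

section Acceleration

variable {F : Type*} [NormedAddCommGroup F] [InnerProductSpace ℝ F] {L μ : ℝ}

theorem apply_sub_inv_smul_le {φ : F → ℝ} {x g : F} (hL : 0 < L)
    (h : ∀ y, φ y - φ x - inner ℝ g (y - x) ≤ L / 2 * ‖y - x‖ ^ 2) :
    φ (x - L⁻¹ • g) ≤ φ x - ‖g‖ ^ 2 / (2 * L) := by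
  have hstep := h (x - L⁻¹ • g)
  rw [sub_sub_cancel_left, inner_neg_right, inner_smul_right, norm_neg, norm_smul,
    real_inner_self_eq_norm_sq, mul_pow, Real.norm_eq_abs, sq_abs] at hstep
  have hsq : L / 2 * (L⁻¹ ^ 2 * ‖g‖ ^ 2) = L⁻¹ * ‖g‖ ^ 2 - ‖g‖ ^ 2 / (2 * L) := by
    field_simp
    ring
  linarith

/-- The vector `z'` of the hypothesis minimizes
`B / 2 * ‖v - z‖ ^ 2 + b / 2 * ‖v - x‖ ^ 2 + ⟪g, v⟫`, whose value at `w` exceeds the minimum by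
`(B + b) / 2 * ‖z' - w‖ ^ 2`. -/
theorem norm_sub_sq_of_add_smul_eq {x z z' g : F} {B b : ℝ}
    (hz' : (B + b) • z' = B • z + b • x - g) (w : F) :
    (B + b) / 2 * ‖z' - w‖ ^ 2 = B / 2 * ‖z - w‖ ^ 2 + b / 2 * ‖x - w‖ ^ 2 -
      B / 2 * ‖z' - z‖ ^ 2 - b / 2 * ‖z' - x‖ ^ 2 - inner ℝ g (z' - w) := by
  have hinner := congrArg (inner ℝ · (z' - w)) hz'
  simp only [inner_add_left, inner_sub_left, inner_sub_right, real_inner_smul_left,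
    real_inner_self_eq_norm_sq, real_inner_comm z' z, real_inner_comm z' x] at hinner
  simp only [norm_sub_sq_real, inner_sub_right]
  linear_combination hinner

theorem neg_mul_inner_le {g w : F} {B a : ℝ} (hB : 0 < B) :
    -(a * inner ℝ g w) ≤ B / 2 * ‖w‖ ^ 2 + a ^ 2 * ‖g‖ ^ 2 / (2 * B) := by
  have hsq : 0 ≤ ‖B • w + a • g‖ ^ 2 / (2 * B) := by positivity
  rw [norm_add_sq_real, norm_smul, norm_smul, real_inner_smul_left, inner_smul_right,
    real_inner_comm, mul_pow, mul_pow, Real.norm_eq_abs, Real.norm_eq_abs, sq_abs, sq_abs] at hsq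
  have hexpand : (B ^ 2 * ‖w‖ ^ 2 + 2 * (B * (a * inner ℝ g w)) + a ^ 2 * ‖g‖ ^ 2) / (2 * B) =
      B / 2 * ‖w‖ ^ 2 + a * inner ℝ g w + a ^ 2 * ‖g‖ ^ 2 / (2 * B) := by
    field_simp
  linarith

theorem accelerated_potential_le {x y z z' xs g : F} {A a B fx fy fy' fs : ℝ} (hL : 0 < L)
    (hμ : 0 ≤ μ) (hA : 0 ≤ A) (ha : 0 ≤ a) (hB : 0 < B)
    (hy' : fy' ≤ fx - ‖g‖ ^ 2 / (2 * L)) (hy : fx + inner ℝ g (y - x) ≤ fy)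
    (hs : fx + inner ℝ g (xs - x) + μ / 2 * ‖xs - x‖ ^ 2 ≤ fs)
    (hx : (A + a) • x = A • y + a • z)
    (hz' : (B + μ * a) • z' = B • z + (μ * a) • x - a • g)
    (hLa : L * a ^ 2 ≤ (A + a) * B) :
    (A + a) * (fy' - fs) + (B + μ * a) / 2 * ‖z' - xs‖ ^ 2 ≤
      A * (fy - fs) + B / 2 * ‖z - xs‖ ^ 2 := by
  have hcoupling : A * inner ℝ g (y - x) + a * inner ℝ g (z - x) = 0 := by
    have hinner := congrArg (inner ℝ g) hx
    simp only [inner_add_right, inner_smul_right] at hinner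
    simp only [inner_sub_right]
    linarith
  have hyoung := neg_mul_inner_le (g := g) (w := z' - z) (a := a) hB
  have hgain : a ^ 2 * ‖g‖ ^ 2 / (2 * B) ≤ (A + a) * (‖g‖ ^ 2 / (2 * L)) := by
    rw [← mul_div_assoc, div_le_div_iff₀ (by positivity) (by positivity)]
    nlinarith [mul_le_mul_of_nonneg_right hLa (sq_nonneg ‖g‖)]
  have hdist : 0 ≤ μ * a / 2 * ‖z' - x‖ ^ 2 := by positivity
  have hy'_mul := mul_le_mul_of_nonneg_left hy' (add_nonneg hA ha)
  have hy_mul := mul_le_mul_of_nonneg_left hy hA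
  have hs_mul := mul_le_mul_of_nonneg_left hs ha
  rw [norm_sub_sq_of_add_smul_eq hz' xs, real_inner_smul_left, norm_sub_rev x xs]
  simp only [inner_sub_right] at *
  linarith

/-- The point at which the accelerated gradient method evaluates the gradient in round `k`. -/
def accQuery (L μ : ℝ) (k : ℕ) (p : F × F) : F :=
  (accWeight L μ (k + 1) ^ 2)⁻¹ • (accWeight L μ k ^ 2 • p.1 +
    (accWeight L μ (k + 1) ^ 2 - accWeight L μ k ^ 2) • p.2)

/-- The update of the two sequences of the accelerated gradient method in round `k`, where `g` is
the gradient at the query point. -/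
def accStep (L μ : ℝ) (k : ℕ) (g : F) (p : F × F) : F × F :=
  (accQuery L μ k p - L⁻¹ • g,
    (1 + μ * accWeight L μ (k + 1) ^ 2)⁻¹ •
      ((1 + μ * accWeight L μ k ^ 2) • p.2 +
        (μ * (accWeight L μ (k + 1) ^ 2 - accWeight L μ k ^ 2)) • accQuery L μ k p -
        (accWeight L μ (k + 1) ^ 2 - accWeight L μ k ^ 2) • g))

/-- The two sequences of the accelerated gradient method, fed with the gradients `G k`. -/
def accState (L μ : ℝ) (G : ℕ → F) : ℕ → F × F
  | 0 => 0
  | k + 1 => accStep L μ k (G k) (accState L μ G k)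

theorem accState_congr (L μ : ℝ) {G G' : ℕ → F} (t : ℕ) (h : ∀ k < t, G k = G' k) :
    accState L μ G t = accState L μ G' t := by
  induction t with
  | zero => rfl
  | succ t ih =>
    rw [accState, accState, ih fun k hk => h k (hk.trans t.lt_succ_self), h t t.lt_succ_self]

theorem measurable_accState {α : Type*} [MeasurableSpace α] [MeasurableSpace F] [BorelSpace F]
    [SecondCountableTopology F] (L μ : ℝ) {G : α → ℕ → F} (hG : ∀ k, Measurable fun a => G a k)
    (t : ℕ) : Measurable fun a => accState L μ (G a) t := by
  induction t with
  | zero => exact measurable_const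
  | succ t ih =>
    have hGt := hG t
    simp only [accState, accStep, accQuery]
    fun_prop

theorem accQuery_mem {V : Submodule ℝ F} {p : F × F} (h1 : p.1 ∈ V) (h2 : p.2 ∈ V) (k : ℕ) :
    accQuery L μ k p ∈ V :=
  V.smul_mem _ (V.add_mem (V.smul_mem _ h1) (V.smul_mem _ h2))

theorem accState_mem {V : Submodule ℝ F} {G : ℕ → F} (t : ℕ) (hG : ∀ k < t, G k ∈ V) :
    (accState L μ G t).1 ∈ V ∧ (accState L μ G t).2 ∈ V := by
  induction t with
  | zero => exact ⟨V.zero_mem, V.zero_mem⟩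
  | succ t ih =>
    obtain ⟨h1, h2⟩ := ih fun k hk => hG k (hk.trans t.lt_succ_self)
    have hquery : accQuery L μ t (accState L μ G t) ∈ V := accQuery_mem h1 h2 t
    have hgrad := hG t t.lt_succ_self
    exact ⟨V.sub_mem hquery (V.smul_mem _ hgrad), V.smul_mem _ (V.sub_mem
      (V.add_mem (V.smul_mem _ h2) (V.smul_mem _ hquery)) (V.smul_mem _ hgrad))⟩

/-- The Lyapunov function of the accelerated gradient method with respect to the point `xs`. -/
def accPotential (L μ : ℝ) (φ : F → ℝ) (xs : F) (k : ℕ) (p : F × F) : ℝ :=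
  accWeight L μ k ^ 2 * (φ p.1 - φ xs) + (1 + μ * accWeight L μ k ^ 2) / 2 * ‖p.2 - xs‖ ^ 2

theorem accPotential_accStep_le {φ : F → ℝ} {g xs : F} {k : ℕ} {p : F × F} (hL : 0 < L)
    (hμ : 0 ≤ μ)
    (hlower : ∀ y, μ / 2 * ‖y - accQuery L μ k p‖ ^ 2 ≤
      φ y - φ (accQuery L μ k p) - inner ℝ g (y - accQuery L μ k p))
    (hupper : ∀ y, φ y - φ (accQuery L μ k p) - inner ℝ g (y - accQuery L μ k p) ≤
      L / 2 * ‖y - accQuery L μ k p‖ ^ 2) :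
    accPotential L μ φ xs (k + 1) (accStep L μ k g p) ≤ accPotential L μ φ xs k p := by
  have hpos := accWeight_succ_pos hL hμ k
  have hle : accWeight L μ k ^ 2 ≤ accWeight L μ (k + 1) ^ 2 :=
    pow_le_pow_left₀ (accWeight_nonneg k) (accWeight_le_succ k) 2
  have hA : accWeight L μ k ^ 2 + (accWeight L μ (k + 1) ^ 2 - accWeight L μ k ^ 2) =
      accWeight L μ (k + 1) ^ 2 := by ring
  have hB : 1 + μ * accWeight L μ k ^ 2 +
      μ * (accWeight L μ (k + 1) ^ 2 - accWeight L μ k ^ 2) =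
      1 + μ * accWeight L μ (k + 1) ^ 2 := by ring
  have hkey := accelerated_potential_le (xs := xs) (y := p.1) (z := p.2)
    (z' := (accStep L μ k g p).2) (A := accWeight L μ k ^ 2)
    (a := accWeight L μ (k + 1) ^ 2 - accWeight L μ k ^ 2) (B := 1 + μ * accWeight L μ k ^ 2)
    (fy := φ p.1) (fs := φ xs) hL hμ (by positivity) (by linarith) (by positivity)
    (apply_sub_inv_smul_le hL hupper)
    (by linarith [hlower p.1, show 0 ≤ μ / 2 * ‖p.1 - accQuery L μ k p‖ ^ 2 by positivity])
    (by linarith [hlower xs])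
    (by rw [hA, accQuery, smul_inv_smul₀ (by positivity)])
    (by rw [hB, accStep, smul_inv_smul₀ (by positivity)])
    (by rw [hA]; exact mul_accWeight_sq_sub_sq_le hL hμ k)
  rwa [hA, hB] at hkey

theorem mul_apply_accState_sub_le {φ : F → ℝ} {g : F → F} {G : ℕ → F} (hL : 0 < L) (hμ : 0 ≤ μ)
    (hlower : ∀ x y, μ / 2 * ‖y - x‖ ^ 2 ≤ φ y - φ x - inner ℝ (g x) (y - x))
    (hupper : ∀ x y, φ y - φ x - inner ℝ (g x) (y - x) ≤ L / 2 * ‖y - x‖ ^ 2)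
    (hG : ∀ k, G k = g (accQuery L μ k (accState L μ G k))) (xs : F) (t : ℕ) :
    accWeight L μ t ^ 2 * (φ (accState L μ G t).1 - φ xs) ≤ ‖xs‖ ^ 2 / 2 := by
  have hpotential : accPotential L μ φ xs t (accState L μ G t) ≤ ‖xs‖ ^ 2 / 2 := by
    induction t with
    | zero => simp [accPotential, accWeight, accState, div_eq_inv_mul]
    | succ t ih =>
      refine le_trans ?_ ih
      rw [accState, hG]
      exact accPotential_accStep_le hL hμ (hlower _) (hupper _)
  refine le_trans (le_add_of_nonneg_right ?_) hpotential
  positivity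

end Acceleration

/-! ### The distributed accelerated gradient method -/

section Average

variable {n d : ℕ} {L μ Δ : ℝ} {f : Fin n → E d → ℝ}

/-- The gradient of the averaged objective, as the average of the gradients of the workers. -/
def avgGrad (f : Fin n → E d → ℝ) (x : E d) : E d :=
  (n : ℝ)⁻¹ • ∑ i, gradient (f i) x

theorem avg_sub_sub_inner_avgGrad (f : Fin n → E d → ℝ) (x y : E d) :
    avg f y - avg f x - inner ℝ (avgGrad f x) (y - x) =
      (n : ℝ)⁻¹ * ∑ i, (f i y - f i x - inner ℝ (gradient (f i) x) (y - x)) := by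
  simp only [avg, avgGrad, real_inner_smul_left, sum_inner, Finset.sum_sub_distrib]
  ring

theorem inv_mul_sum_const (hn : 1 ≤ n) (a : ℝ) : (n : ℝ)⁻¹ * ∑ _i : Fin n, a = a := by
  have : (n : ℝ) ≠ 0 := by positivity
  simp [this]

theorem InClass.avg_lower (h : InClass L μ Δ f) (hn : 1 ≤ n) (x y : E d) :
    μ / 2 * ‖y - x‖ ^ 2 ≤ avg f y - avg f x - inner ℝ (avgGrad f x) (y - x) := by
  rw [avg_sub_sub_inner_avgGrad, ← inv_mul_sum_const hn (μ / 2 * ‖y - x‖ ^ 2)]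
  gcongr with i
  exact h.strong_convex i x y

theorem InClass.avg_upper (h : InClass L μ Δ f) (hn : 1 ≤ n) (x y : E d) :
    avg f y - avg f x - inner ℝ (avgGrad f x) (y - x) ≤ L / 2 * ‖y - x‖ ^ 2 := by
  rw [avg_sub_sub_inner_avgGrad, ← inv_mul_sum_const hn (L / 2 * ‖y - x‖ ^ 2)]
  gcongr with i
  exact h.smooth i x y

theorem iInf_avg_eq {xs : E d} (hxs : ∀ y, avg f xs ≤ avg f y) : ⨅ x, avg f x = avg f xs :=
  le_antisymm (ciInf_le ⟨avg f xs, Set.forall_mem_range.mpr hxs⟩ xs) (le_ciInf hxs)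

end Average

theorem measurable_gradient {d : ℕ} (φ : E d → ℝ) : Measurable (gradient φ) :=
  (InnerProductSpace.toDual ℝ (E d)).symm.continuous.measurable.comp (measurable_fderiv ℝ φ)

/-- The averages of the messages received in the past rounds, extended by `0` to all rounds. -/
def avgHistory {n d t : ℕ} (h : Fin t → Fin n → E d) (k : ℕ) : E d :=
  if hk : k < t then (n : ℝ)⁻¹ • ∑ i, h ⟨k, hk⟩ i else 0

theorem measurable_accState_avgHistory (n d : ℕ) (L μ : ℝ) (t : ℕ) :
    Measurable fun p : Unit × (Fin t → Fin n → E d) => accState L μ (avgHistory p.2) t := by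
  refine measurable_accState L μ (fun k => ?_) t
  unfold avgHistory
  split_ifs <;> fun_prop

/-- The distributed accelerated gradient method: the server broadcasts the query point, and the
workers reply with their gradients. -/
def acceleratedGradient (n d : ℕ) (L μ : ℝ) : Algorithm.{0} n d where
  Coin := Unit
  coinLaw := Measure.dirac ()
  broadcast := fun t _ h => accQuery L μ t (accState L μ (avgHistory h) t)
  query := fun _ t _ _ u _ => {u (Fin.last t)}
  message := fun _ t _ φ u _ => gradient φ (u (Fin.last t))
  output := fun t _ h => (accState L μ (avgHistory h) t).1
  measurable_broadcast := fun t => by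
    have := measurable_accState_avgHistory n d L μ t
    simp only [accQuery]
    fun_prop
  measurable_message := fun _ t φ => (measurable_gradient φ).comp (by fun_prop)
  measurable_output := fun t => (measurable_accState_avgHistory n d L μ t).fst

namespace acceleratedGradient

variable {n d : ℕ} {L μ : ℝ} (f : Fin n → E d → ℝ)
  (c : (acceleratedGradient n d L μ).Coin) (ξ : ℕ → (noCompression n d).Seed)

theorem recv_eq (t : ℕ) (i : Fin n) :
    (acceleratedGradient n d L μ).recv f (noCompression n d) c ξ t i =
      gradient (f i) ((acceleratedGradient n d L μ).sent f (noCompression n d) c ξ t) := by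
  rw [Algorithm.recv]
  rfl

theorem accState_avgHistory_recv (t : ℕ) :
    accState L μ (avgHistory fun (r : Fin t) (j : Fin n) =>
      (acceleratedGradient n d L μ).recv f (noCompression n d) c ξ r j) t =
    accState L μ (fun k => avgGrad f
      ((acceleratedGradient n d L μ).sent f (noCompression n d) c ξ k)) t := by
  refine accState_congr L μ t fun k hk => ?_
  simp only [avgHistory, dif_pos hk, recv_eq]
  rfl

theorem sent_eq (t : ℕ) :
    (acceleratedGradient n d L μ).sent f (noCompression n d) c ξ t =
      accQuery L μ t (accState L μ (fun k => avgGrad f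
        ((acceleratedGradient n d L μ).sent f (noCompression n d) c ξ k)) t) := by
  rw [← accState_avgHistory_recv]
  rfl

theorem out_eq (t : ℕ) :
    (acceleratedGradient n d L μ).out f (noCompression n d) c ξ t =
      (accState L μ (fun k => avgGrad f
        ((acceleratedGradient n d L μ).sent f (noCompression n d) c ξ k)) t).1 := by
  rw [← accState_avgHistory_recv]
  rfl

theorem avgGrad_mem_span_recv {t k : ℕ} (hk : k < t) :
    avgGrad f ((acceleratedGradient n d L μ).sent f (noCompression n d) c ξ k) ∈
      Submodule.span ℝ
        ({x | ∃ r < t, x = (acceleratedGradient n d L μ).sent f (noCompression n d) c ξ r} ∪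
          {x | ∃ r < t, ∃ i, x =
            (acceleratedGradient n d L μ).recv f (noCompression n d) c ξ r i}) :=
  Submodule.smul_mem _ _ (Submodule.sum_mem _ fun i _ =>
    Submodule.subset_span (Or.inr ⟨k, hk, i, (recv_eq f c ξ k i).symm⟩))

theorem linearSpanning : (acceleratedGradient n d L μ).LinearSpanning f (noCompression n d) where
  sent_mem c ξ t := by
    rw [sent_eq]
    obtain ⟨h1, h2⟩ := accState_mem (L := L) (μ := μ) t fun k => avgGrad_mem_span_recv f c ξ
    exact accQuery_mem h1 h2 t
  queries_subset c ξ t i := by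
    rintro _ rfl
    exact Submodule.subset_span (Or.inl (Or.inl ⟨t, le_rfl, rfl⟩))
  msg_mem c ξ t i := Submodule.subset_span
    (Or.inl (Or.inr ⟨t, le_rfl, _, Set.mem_singleton _, rfl⟩))
  out_mem c ξ t := by
    rw [out_eq]
    exact (accState_mem t fun k => avgGrad_mem_span_recv f c ξ).1

variable {f} {Δ ε : ℝ} {t : ℕ}

theorem rounds_le (h : InClass L μ Δ f) (hn : 1 ≤ n) (hL : 0 < L) (hμ : 0 ≤ μ)
    (ht : Δ ≤ 2 * ε * accWeight L μ t ^ 2) (hpos : 0 < accWeight L μ t) :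
    (acceleratedGradient n d L μ).rounds f (noCompression n d) ε ≤ t := by
  obtain ⟨xs, hxs, hΔ⟩ := h.minimizer
  rw [zero_sub, norm_neg] at hΔ
  have hgap (c ξ) : avg f ((acceleratedGradient n d L μ).out f (noCompression n d) c ξ t) -
      avg f xs ≤ ε := by
    have hkey := mul_apply_accState_sub_le hL hμ (h.avg_lower hn) (h.avg_upper hn)
      (fun k => congrArg (avgGrad f) (sent_eq f c ξ k)) xs t
    rw [out_eq]
    exact le_of_mul_le_mul_left (hkey.trans (by linarith)) (pow_pos hpos 2)
  refine iInf₂_le t ?_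
  calc (acceleratedGradient n d L μ).expectedGap f (noCompression n d) t
      ≤ ∫⁻ _p, ENNReal.ofReal ε ∂((acceleratedGradient n d L μ).coinLaw.prod
          (Measure.infinitePi fun _ : ℕ => (noCompression n d).law)) := by
        rw [Algorithm.expectedGap, iInf_avg_eq hxs]
        exact lintegral_mono fun p => ENNReal.ofReal_le_ofReal (hgap p.1 p.2)
    _ = ENNReal.ofReal ε := by simp

theorem tcc_le {K : ℝ} (h : InClass L μ Δ f) (hn : 1 ≤ n) (hL : 0 < L) (hμ : 0 ≤ μ)
    (ht : Δ ≤ 2 * ε * accWeight L μ t ^ 2) (hpos : 0 < accWeight L μ t) (hK : t ≤ K) (r : ℕ) :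
    (acceleratedGradient n d L μ).tcc f (noCompression n d) r ε ≤ ENNReal.ofReal (r * d * K) := by
  have hcost : ((noCompression n d).perRoundCost r : ℝ≥0∞) ≤ (r * d : ℕ) := by
    exact_mod_cast ENat.toENNReal_le.mpr (perRoundCost_noCompression_le n d r)
  have hrounds : ((acceleratedGradient n d L μ).rounds f (noCompression n d) ε : ℝ≥0∞) ≤ t := by
    exact_mod_cast ENat.toENNReal_le.mpr (rounds_le h hn hL hμ ht hpos)
  calc (acceleratedGradient n d L μ).tcc f (noCompression n d) r ε
      ≤ ((r * d : ℕ) : ℝ≥0∞) * (t : ℝ≥0∞) := mul_le_mul' hcost hrounds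
    _ = ENNReal.ofReal (r * d * t) := by
        rw [← Nat.cast_mul, ← ENNReal.ofReal_natCast]
        push_cast
        rfl
    _ ≤ ENNReal.ofReal (r * d * K) := by gcongr

end acceleratedGradient

theorem one_le_log_div {a ε : ℝ} (hε : 0 < ε) (hεa : ε ≤ Real.exp (-1) * a) :
    1 ≤ Real.log (a / ε) := by
  have ha : 0 < a := pos_of_mul_pos_right (hε.trans_le hεa) (Real.exp_pos _).le
  rwa [Real.le_log_iff_exp_le (by positivity), le_div_iff₀ hε, ← le_div_iff₀' (Real.exp_pos 1),
    div_eq_inv_mul, ← Real.exp_neg]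

theorem exp_le_sq_one_add_half_pow {s y : ℝ} {k : ℕ} (hs : 0 ≤ s) (hs1 : s ≤ 1)
    (hk : 3 / 2 * y ≤ k * s) : Real.exp y ≤ ((1 + s / 2) ^ k) ^ 2 := by
  have hlog : 2 / 5 * s ≤ Real.log (1 + s / 2) := by
    refine le_trans ?_ (Real.le_log_one_add_of_nonneg (by positivity))
    rw [le_div_iff₀ (by positivity)]
    nlinarith
  rw [← pow_mul, ← Real.le_log_iff_exp_le (by positivity), Real.log_pow]
  push_cast
  nlinarith [mul_le_mul_of_nonneg_left hlog (Nat.cast_nonneg (α := ℝ) k),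
    mul_nonneg (Nat.cast_nonneg (α := ℝ) k) hs]

section Complexity

variable {n d : ℕ} {L μ Δ ε : ℝ}

theorem one_div_le_accWeight_ceil_sqrt_sq (hL : 0 < L) (hμ : 0 < μ) :
    1 / (4 * μ) ≤ accWeight L μ ⌈√(L / μ)⌉₊ ^ 2 := by
  have hle : √(L / μ) / (2 * √L) ≤ accWeight L μ ⌈√(L / μ)⌉₊ :=
    le_trans (by gcongr; exact Nat.le_ceil _) (div_two_mul_sqrt_le_accWeight hL hμ.le _)
  refine le_trans (le_of_eq ?_) (pow_le_pow_left₀ (by positivity) hle 2)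
  rw [div_pow, mul_pow, Real.sq_sqrt (by positivity), Real.sq_sqrt hL.le]
  field_simp
  norm_num

theorem le_two_mul_accWeight_sq (hμ : 0 < μ) (hLμ : μ ≤ L) (hε : 0 < ε) (hΔ : 0 < Δ) {k : ℕ}
    (hk : 3 / 2 * (Real.log (μ * Δ / ε) + 1) ≤ k * √(μ / L)) :
    Δ ≤ 2 * ε * accWeight L μ (⌈√(L / μ)⌉₊ + k) ^ 2 := by
  have hL : 0 < L := hμ.trans_le hLμ
  have hpow : 2 * (μ * Δ / ε) ≤ ((1 + √(μ / L) / 2) ^ k) ^ 2 := by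
    refine le_trans ?_ (exp_le_sq_one_add_half_pow (Real.sqrt_nonneg _)
      (Real.sqrt_le_one.mpr ((div_le_one hL).mpr hLμ)) hk)
    rw [Real.exp_add, Real.exp_log (by positivity), mul_comm]
    gcongr
    linarith [Real.add_one_le_exp 1]
  calc Δ = 2 * ε * (1 / (4 * μ) * (2 * (μ * Δ / ε))) := by field_simp; norm_num
    _ ≤ 2 * ε * (accWeight L μ ⌈√(L / μ)⌉₊ ^ 2 * ((1 + √(μ / L) / 2) ^ k) ^ 2) := by
        gcongr
        exact one_div_le_accWeight_ceil_sqrt_sq hL hμ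
    _ ≤ 2 * ε * accWeight L μ (⌈√(L / μ)⌉₊ + k) ^ 2 := by
        rw [← mul_pow]
        have := accWeight_nonneg (L := L) (μ := μ) ⌈√(L / μ)⌉₊
        gcongr
        exact accWeight_mul_pow_le hL hμ.le _ k

variable {f : Fin n → E d → ℝ}

theorem InClass.tcc_acceleratedGradient_le (h : InClass L μ Δ f) (hn : 1 ≤ n) (hμ : 0 < μ)
    (hLμ : μ ≤ L) (r : ℕ) (hε : 0 < ε) (hεΔ : ε ≤ Real.exp (-1) * (μ * Δ)) :
    (acceleratedGradient n d L μ).tcc f (noCompression n d) r ε ≤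
      ENNReal.ofReal (8 * (r * d * (√(L / μ) * Real.log (μ * Δ / ε)))) := by
  have hL : 0 < L := hμ.trans_le hLμ
  have hΔ : 0 < Δ := pos_of_mul_pos_right
    (pos_of_mul_pos_right (hε.trans_le hεΔ) (Real.exp_pos _).le) hμ.le
  have hκ : 1 ≤ √(L / μ) := Real.one_le_sqrt.mpr ((one_le_div hμ).mpr hLμ)
  have hlog := one_le_log_div hε hεΔ
  have hinv : √(L / μ) * √(μ / L) = 1 := by
    rw [← Real.sqrt_mul (by positivity), div_mul_div_cancel₀ hμ.ne', div_self hL.ne',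
      Real.sqrt_one]
  set k := ⌈3 / 2 * (Real.log (μ * Δ / ε) + 1) * √(L / μ)⌉₊
  have hk_ge : 3 / 2 * (Real.log (μ * Δ / ε) + 1) ≤ k * √(μ / L) :=
    calc 3 / 2 * (Real.log (μ * Δ / ε) + 1)
        = 3 / 2 * (Real.log (μ * Δ / ε) + 1) * √(L / μ) * √(μ / L) := by
          rw [mul_assoc _ (√(L / μ)), hinv, mul_one]
      _ ≤ k * √(μ / L) := by gcongr; exact Nat.le_ceil _
  have hk_le : (k : ℝ) ≤ 3 / 2 * (Real.log (μ * Δ / ε) + 1) * √(L / μ) + 1 :=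
    (Nat.ceil_lt_add_one (by positivity)).le
  have hj_le : (⌈√(L / μ)⌉₊ : ℝ) ≤ √(L / μ) + 1 := (Nat.ceil_lt_add_one (by positivity)).le
  have hpos : 0 < accWeight L μ (⌈√(L / μ)⌉₊ + k) := by
    obtain ⟨j, hj⟩ := Nat.exists_eq_add_one.mpr (Nat.ceil_pos.mpr (zero_lt_one.trans_le hκ))
    rw [hj, Nat.add_right_comm]
    exact accWeight_succ_pos hL hμ.le _
  refine (acceleratedGradient.tcc_le h hn hL hμ.le (le_two_mul_accWeight_sq hμ hLμ hε hΔ hk_ge) hpos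
    (K := 8 * (√(L / μ) * Real.log (μ * Δ / ε))) ?_ r).trans_eq (by congr 1; ring)
  push_cast
  nlinarith [mul_le_mul hκ hlog zero_le_one (by positivity)]

theorem InClass.tcc_acceleratedGradient_zero_le (h : InClass L 0 Δ f) (hn : 1 ≤ n) (hL : 0 < L)
    (r : ℕ) (hε : 0 < ε) (hεΔ : ε ≤ L * Δ) :
    (acceleratedGradient n d L 0).tcc f (noCompression n d) r ε ≤
      ENNReal.ofReal (8 * (r * d * √(L * Δ / ε))) := by
  have hΔ : 0 < Δ := pos_of_mul_pos_right (hε.trans_le hεΔ) hL.le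
  set w := √(L * Δ / ε) with hw
  have hw_one : 1 ≤ w := Real.one_le_sqrt.mpr ((one_le_div hε).mpr hεΔ)
  set t := ⌈2 * w⌉₊
  have hweight : w / √L ≤ accWeight L 0 t :=
    calc w / √L = 2 * w / (2 * √L) := by field_simp
      _ ≤ t / (2 * √L) := by gcongr; exact Nat.le_ceil _
      _ ≤ accWeight L 0 t := div_two_mul_sqrt_le_accWeight hL le_rfl t
  have ht : Δ ≤ 2 * ε * accWeight L 0 t ^ 2 :=
    calc Δ ≤ 2 * Δ := by linarith
      _ = 2 * ε * (w / √L) ^ 2 := by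
          rw [div_pow, hw, Real.sq_sqrt (by positivity), Real.sq_sqrt hL.le]
          field_simp
      _ ≤ 2 * ε * accWeight L 0 t ^ 2 := by gcongr
  have ht_le : (t : ℝ) ≤ 2 * w + 1 := (Nat.ceil_lt_add_one (by positivity)).le
  exact (acceleratedGradient.tcc_le h hn hL le_rfl ht
    ((by positivity : 0 < w / √L).trans_le hweight)
    (K := 8 * w) (by linarith) r).trans_eq (by congr 1; ring)

end Complexity

/-! ### Quadratic functions on a chain of coordinates -/

theorem hasGradientAt_of_isBigO {F : Type*} [NormedAddCommGroup F] [InnerProductSpace ℝ F]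
    [CompleteSpace F] {φ : F → ℝ} {g x : F}
    (h : (fun y => φ y - φ x - inner ℝ g (y - x)) =O[nhds x] fun y => ‖y - x‖ ^ 2) :
    HasGradientAt φ g x :=
  hasGradientAt_iff_isLittleO.mpr
    (h.trans_isLittleO (Asymptotics.isLittleO_pow_sub_sub x one_lt_two))

theorem sum_ite_mod_two_eq_add_succ_le {u : ℕ → ℝ} (hu : ∀ j, 0 ≤ u j) (p N : ℕ) :
    ∑ j ∈ Finset.range N, (if j % 2 = p then u j + u (j + 1) else 0) ≤
      ∑ j ∈ Finset.range N, u j + if N % 2 = p then 0 else u N := by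
  induction N with
  | zero => simp; split_ifs <;> simp [hu]
  | succ N ih =>
    rw [Finset.sum_range_succ, Finset.sum_range_succ]
    have := hu (N + 1)
    split_ifs at ih ⊢ <;> first | omega | linarith

section Chain

variable {d : ℕ}

/-- The linear form of this vector is `x ↦ x_{j-1} - x_j`, where entries outside the range
`0, …, d - 1` are read as `0`. -/
def linkVec (d j : ℕ) : E d :=
  WithLp.toLp 2 fun k => (if (k : ℕ) + 1 = j then 1 else 0) - (if (k : ℕ) = j then 1 else 0)

/-- The entries of `x`, shifted by one and extended by `0`. -/
def shiftExt (x : E d) (j : ℕ) : ℝ := ∑ k : Fin d, if (k : ℕ) + 1 = j then x k else 0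

theorem shiftExt_zero (x : E d) : shiftExt x 0 = 0 := by simp [shiftExt]

theorem shiftExt_succ (x : E d) {k : ℕ} (hk : k < d) : shiftExt x (k + 1) = x ⟨k, hk⟩ := by
  have h (l : Fin d) : (l : ℕ) + 1 = k + 1 ↔ l = ⟨k, hk⟩ := by simp [Fin.ext_iff]
  simp only [shiftExt, h, Finset.sum_ite_eq', Finset.mem_univ, if_true]

theorem shiftExt_succ_of_le (x : E d) {k : ℕ} (hk : d ≤ k) : shiftExt x (k + 1) = 0 :=
  Finset.sum_eq_zero fun l _ => if_neg (by have := l.isLt; omega)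

theorem inner_linkVec (x : E d) (j : ℕ) :
    inner ℝ (linkVec d j) x = shiftExt x j - shiftExt x (j + 1) := by
  simp [linkVec, shiftExt, PiLp.inner_apply, mul_sub, Finset.sum_sub_distrib]

theorem sum_shiftExt_sq (x : E d) : ∑ j ∈ Finset.range (d + 1), shiftExt x j ^ 2 = ‖x‖ ^ 2 := by
  rw [Finset.sum_range_succ', shiftExt_zero, EuclideanSpace.real_norm_sq_eq, Finset.sum_range]
  simp [shiftExt_succ]

-- The links of equal parity involve disjoint pairs of coordinates.
theorem sum_ite_inner_linkVec_sq_le (x : E d) (p : ℕ) :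
    ∑ j ∈ Finset.range (d + 1), (if j % 2 = p then inner ℝ (linkVec d j) x ^ 2 else 0) ≤
      2 * ‖x‖ ^ 2 := by
  calc ∑ j ∈ Finset.range (d + 1), (if j % 2 = p then inner ℝ (linkVec d j) x ^ 2 else 0)
      ≤ ∑ j ∈ Finset.range (d + 1),
          (if j % 2 = p then 2 * shiftExt x j ^ 2 + 2 * shiftExt x (j + 1) ^ 2 else 0) := by
        gcongr with j
        split_ifs
        · rw [inner_linkVec]
          nlinarith [sq_nonneg (shiftExt x j + shiftExt x (j + 1))]
        · exact le_rfl
    _ ≤ ∑ j ∈ Finset.range (d + 1), 2 * shiftExt x j ^ 2 +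
          if (d + 1) % 2 = p then 0 else 2 * shiftExt x (d + 1) ^ 2 :=
        sum_ite_mod_two_eq_add_succ_le (u := fun j => 2 * shiftExt x j ^ 2)
          (fun j => by positivity) p (d + 1)
    _ = 2 * ‖x‖ ^ 2 := by
        rw [← Finset.mul_sum, sum_shiftExt_sq, shiftExt_succ_of_le x le_rfl]
        simp

/-- The link `x_{j-1} - x_j` of the chain that starts with `x_{-1} = a`. -/
def chainLink (a : ℝ) (x : E d) (j : ℕ) : ℝ := inner ℝ (linkVec d j) x + if j = 0 then a else 0

theorem inner_linkVec_sub (a : ℝ) (x y : E d) (j : ℕ) :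
    inner ℝ (linkVec d j) (y - x) = chainLink a y j - chainLink a x j := by
  rw [chainLink, chainLink, inner_sub_right]
  ring

/-- The quadratic function with weight `c j` on the square of the `j`-th link of the chain, for
`j = 0, …, d`. -/
def chainQuad (μ a : ℝ) (c : ℕ → ℝ) (x : E d) : ℝ :=
  μ / 2 * ‖x‖ ^ 2 + 1 / 2 * ∑ j ∈ Finset.range (d + 1), c j * chainLink a x j ^ 2

/-- The gradient of `chainQuad`. -/
def chainGrad (μ a : ℝ) (c : ℕ → ℝ) (x : E d) : E d :=
  μ • x + ∑ j ∈ Finset.range (d + 1), (c j * chainLink a x j) • linkVec d j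

theorem chainQuad_sub_sub_inner (μ a : ℝ) (c : ℕ → ℝ) (x y : E d) :
    chainQuad μ a c y - chainQuad μ a c x - inner ℝ (chainGrad μ a c x) (y - x) =
      μ / 2 * ‖y - x‖ ^ 2 +
        1 / 2 * ∑ j ∈ Finset.range (d + 1), c j * inner ℝ (linkVec d j) (y - x) ^ 2 := by
  have hnorm : μ / 2 * ‖y‖ ^ 2 - μ / 2 * ‖x‖ ^ 2 - μ * inner ℝ x (y - x) =
      μ / 2 * ‖y - x‖ ^ 2 := by
    rw [norm_sub_sq_real, inner_sub_right, real_inner_self_eq_norm_sq, real_inner_comm y x]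
    ring
  have hlinks : 1 / 2 * ∑ j ∈ Finset.range (d + 1), c j * chainLink a y j ^ 2 -
      1 / 2 * ∑ j ∈ Finset.range (d + 1), c j * chainLink a x j ^ 2 -
      ∑ j ∈ Finset.range (d + 1), c j * chainLink a x j * inner ℝ (linkVec d j) (y - x) =
      1 / 2 * ∑ j ∈ Finset.range (d + 1), c j * inner ℝ (linkVec d j) (y - x) ^ 2 := by
    simp only [inner_linkVec_sub a, Finset.mul_sum]
    rw [← Finset.sum_sub_distrib, ← Finset.sum_sub_distrib]
    exact Finset.sum_congr rfl fun j _ => by ring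
  rw [← hnorm, ← hlinks, chainQuad, chainQuad, chainGrad, inner_add_left, real_inner_smul_left,
    sum_inner]
  simp only [real_inner_smul_left]
  ring

theorem hasGradientAt_chainQuad (μ a : ℝ) (c : ℕ → ℝ) (x : E d) :
    HasGradientAt (chainQuad μ a c) (chainGrad μ a c x) x := by
  refine hasGradientAt_of_isBigO ?_
  simp_rw [chainQuad_sub_sub_inner μ a c x]
  refine ((Asymptotics.isBigO_refl _ _).const_mul_left _).add
    ((Asymptotics.IsBigO.fun_sum fun j _ => ?_).const_mul_left _)
  refine Asymptotics.IsBigO.const_mul_left (Asymptotics.IsBigO.of_bound (‖linkVec d j‖ ^ 2)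
    (Filter.Eventually.of_forall fun y => ?_)) _
  rw [norm_pow, norm_pow, norm_norm, ← mul_pow]
  exact pow_le_pow_left₀ (norm_nonneg _) (norm_inner_le_norm _ _) 2

theorem chainQuad_lower {μ a : ℝ} {c : ℕ → ℝ} (hc : ∀ j, 0 ≤ c j) (x y : E d) :
    μ / 2 * ‖y - x‖ ^ 2 ≤
      chainQuad μ a c y - chainQuad μ a c x - inner ℝ (chainGrad μ a c x) (y - x) := by
  rw [chainQuad_sub_sub_inner]
  exact le_add_of_nonneg_right (mul_nonneg (by norm_num)
    (Finset.sum_nonneg fun j _ => mul_nonneg (hc j) (sq_nonneg _)))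

theorem chainQuad_upper {μ a M : ℝ} {c : ℕ → ℝ} {p : ℕ} (hM : 0 ≤ M)
    (hc : ∀ j, c j ≤ if j % 2 = p then M else 0) (x y : E d) :
    chainQuad μ a c y - chainQuad μ a c x - inner ℝ (chainGrad μ a c x) (y - x) ≤
      (μ + 2 * M) / 2 * ‖y - x‖ ^ 2 := by
  have hsum : ∑ j ∈ Finset.range (d + 1), c j * inner ℝ (linkVec d j) (y - x) ^ 2 ≤
      M * (2 * ‖y - x‖ ^ 2) :=
    calc ∑ j ∈ Finset.range (d + 1), c j * inner ℝ (linkVec d j) (y - x) ^ 2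
        ≤ ∑ j ∈ Finset.range (d + 1),
            M * (if j % 2 = p then inner ℝ (linkVec d j) (y - x) ^ 2 else 0) := by
          refine Finset.sum_le_sum fun j _ => ?_
          refine (mul_le_mul_of_nonneg_right (hc j) (sq_nonneg _)).trans_eq ?_
          split_ifs <;> simp
      _ ≤ M * (2 * ‖y - x‖ ^ 2) := by
          rw [← Finset.mul_sum]
          gcongr
          exact sum_ite_inner_linkVec_sq_le (y - x) p
  rw [chainQuad_sub_sub_inner]
  linarith

/-- The space of the vectors whose entries vanish from the `k`-th on. -/
def prefixSpace (d k : ℕ) : Submodule ℝ (E d) where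
  carrier := {x | ∀ j : Fin d, k ≤ j → x j = 0}
  zero_mem' := fun _ _ => rfl
  add_mem' := fun hx hy j hj => by simp [hx j hj, hy j hj]
  smul_mem' := fun c x hx j hj => by simp [hx j hj]

theorem prefixSpace_mono {k l : ℕ} (h : k ≤ l) : prefixSpace d k ≤ prefixSpace d l :=
  fun _ hx j hj => hx j (h.trans hj)

theorem shiftExt_eq_zero {k : ℕ} {x : E d} (hx : x ∈ prefixSpace d k) {j : ℕ} (hj : k < j) :
    shiftExt x j = 0 :=
  Finset.sum_eq_zero fun l _ => by
    split_ifs with h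
    · exact hx l (by omega)
    · rfl

theorem chainLink_eq_zero {a : ℝ} {k j : ℕ} {x : E d} (hx : x ∈ prefixSpace d k) (hj : k < j) :
    chainLink a x j = 0 := by
  rw [chainLink, inner_linkVec, shiftExt_eq_zero hx hj, shiftExt_eq_zero hx (by omega),
    if_neg (by omega)]
  simp

theorem linkVec_mem {j k : ℕ} (h : j < k) : linkVec d j ∈ prefixSpace d k := by
  intro l hl
  simp only [linkVec]
  rw [if_neg (by omega), if_neg (by omega), sub_zero]

/-- The length of the prefix of coordinates that a worker with the links of parity `p` reaches from
the first `k` coordinates. -/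
def reach (p k : ℕ) : ℕ := if k % 2 = p then k + 1 else k

theorem le_reach (p k : ℕ) : k ≤ reach p k := by unfold reach; split_ifs <;> omega

theorem reach_le (p k : ℕ) : reach p k ≤ k + 1 := by unfold reach; split_ifs <;> omega

theorem reach_reach (p k : ℕ) : reach p (reach p k) = reach p k := by
  unfold reach; split_ifs <;> omega

theorem reach_mono (p : ℕ) {k l : ℕ} (h : k ≤ l) : reach p k ≤ reach p l := by
  unfold reach; split_ifs <;> omega

theorem lt_of_reach_le {p k j : ℕ} (hj : j % 2 = p) (h : reach p k ≤ j) : k < j := by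
  unfold reach at h
  split_ifs at h
  · omega
  · exact lt_of_le_of_ne h (by rintro rfl; contradiction)

theorem chainGrad_mem {μ a : ℝ} {c : ℕ → ℝ} {p k : ℕ} (hc : ∀ j, j % 2 ≠ p → c j = 0) {x : E d}
    (hx : x ∈ prefixSpace d k) : chainGrad μ a c x ∈ prefixSpace d (reach p k) := by
  refine Submodule.add_mem _ (Submodule.smul_mem _ _ (prefixSpace_mono (le_reach p k) hx))
    (Submodule.sum_mem _ fun j _ => ?_)
  rcases lt_or_ge j (reach p k) with hjk | hjk
  · exact Submodule.smul_mem _ _ (linkVec_mem hjk)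
  · have hzero : c j * chainLink a x j = 0 := by
      by_cases hj : j % 2 = p
      · rw [chainLink_eq_zero hx (lt_of_reach_le hj hjk), mul_zero]
      · rw [hc j hj, zero_mul]
    rw [hzero, zero_smul]
    exact Submodule.zero_mem _

end Chain

/-! ### The hard instance -/

section HardInstance

/-- The number of workers of parity `p` among the workers `0, …, n - 1`, for `p = 0, 1`. -/
def parityCard (n p : ℕ) : ℕ := (n + 1 - p) / 2

theorem sum_ite_mod_two_eq_parityCard (n : ℕ) {p : ℕ} (hp : p < 2) :
    ∑ i : Fin n, (if (i : ℕ) % 2 = p then 1 else 0) = parityCard n p := by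
  rw [Fin.sum_univ_eq_sum_range (fun i => if i % 2 = p then 1 else 0) n]
  unfold parityCard
  induction n with
  | zero => simp; omega
  | succ n ih =>
    rw [Finset.sum_range_succ, ih]
    split_ifs <;> omega

theorem parityCard_pos {n p : ℕ} (hn : 2 ≤ n) (hp : p < 2) : 0 < parityCard n p := by
  unfold parityCard; omega

theorem le_three_mul_parityCard {n p : ℕ} (hn : 2 ≤ n) (hp : p < 2) : n ≤ 3 * parityCard n p := by
  unfold parityCard; omega

theorem natCast_div_parityCard_le {n p : ℕ} (hn : 2 ≤ n) (hp : p < 2) :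
    (n : ℝ) / parityCard n p ≤ 3 := by
  rw [div_le_iff₀ (by exact_mod_cast parityCard_pos hn hp)]
  exact_mod_cast le_three_mul_parityCard hn hp

/-- The weight of the link `j` in the average of the hard instance. The weight of the last link is
chosen such that the minimizer is exactly geometric in spite of the truncation to `d` entries. -/
def linkWeight (d : ℕ) (β q : ℝ) (j : ℕ) : ℝ := β * if j = d then 1 - q else 1

/-- The weight of the link `j` for the workers of parity `p`, who hold the links of parity `p`; it
is scaled such that the average over all the workers is `linkWeight`. -/
def chainWeight (n d : ℕ) (β q : ℝ) (p j : ℕ) : ℝ :=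
  if j % 2 = p then n / parityCard n p * linkWeight d β q j else 0

/-- The local functions of the hard instance: the links of a chain, shared out between the workers
of even and those of odd number. -/
def hardFun (n d : ℕ) (μ a β q : ℝ) (i : Fin n) : E d → ℝ :=
  chainQuad μ a (chainWeight n d β q (i % 2))

/-- The minimizer of the average of the hard instance. -/
def hardMin (d : ℕ) (a q : ℝ) : E d := WithLp.toLp 2 fun k => a * q ^ ((k : ℕ) + 1)

variable {n d : ℕ} {μ a β q Δ : ℝ}

theorem linkWeight_nonneg (hβ : 0 ≤ β) (hq1 : q ≤ 1) (j : ℕ) : 0 ≤ linkWeight d β q j := by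
  unfold linkWeight
  split_ifs
  · exact mul_nonneg hβ (sub_nonneg.mpr hq1)
  · simpa using hβ

theorem linkWeight_le (hβ : 0 ≤ β) (hq0 : 0 ≤ q) (j : ℕ) : linkWeight d β q j ≤ β := by
  refine mul_le_of_le_one_right hβ ?_
  split_ifs <;> linarith

theorem chainWeight_nonneg (hβ : 0 ≤ β) (hq1 : q ≤ 1) (p j : ℕ) :
    0 ≤ chainWeight n d β q p j := by
  unfold chainWeight
  split_ifs
  · exact mul_nonneg (by positivity) (linkWeight_nonneg hβ hq1 j)
  · exact le_rfl

theorem chainWeight_le (hn : 2 ≤ n) (hβ : 0 ≤ β) (hq0 : 0 ≤ q) (hq1 : q ≤ 1) {p : ℕ} (hp : p < 2)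
    (j : ℕ) : chainWeight n d β q p j ≤ if j % 2 = p then 3 * β else 0 := by
  unfold chainWeight
  split_ifs
  · exact mul_le_mul (natCast_div_parityCard_le hn hp) (linkWeight_le hβ hq0 j)
      (linkWeight_nonneg hβ hq1 j) (by norm_num)
  · exact le_rfl

theorem avg_chainWeight (hn : 2 ≤ n) (j : ℕ) :
    1 / (n : ℝ) * ∑ i : Fin n, chainWeight n d β q (i % 2) j = linkWeight d β q j := by
  have hp : j % 2 < 2 := Nat.mod_lt _ two_pos
  have hcard : (parityCard n (j % 2) : ℝ) ≠ 0 := by exact_mod_cast (parityCard_pos hn hp).ne'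
  have hn0 : (n : ℝ) ≠ 0 := by positivity
  have hweight (i : Fin n) : chainWeight n d β q (i % 2) j =
      (if (i : ℕ) % 2 = j % 2 then 1 else 0 : ℕ) *
        (n / parityCard n (j % 2) * linkWeight d β q j) := by
    unfold chainWeight
    by_cases h : j % 2 = i % 2
    · simp [h]
    · simp [h, Ne.symm h]
  simp_rw [hweight]
  rw [← Finset.sum_mul, ← Nat.cast_sum, sum_ite_mod_two_eq_parityCard n hp]
  field_simp

theorem avg_hardFun (hn : 2 ≤ n) (x : E d) :
    avg (hardFun n d μ a β q) x = chainQuad μ a (linkWeight d β q) x := by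
  have hn0 : (n : ℝ) ≠ 0 := by positivity
  simp only [avg, hardFun, chainQuad, ← avg_chainWeight (d := d) (β := β) (q := q) hn,
    Finset.sum_add_distrib, Finset.sum_const, Finset.card_univ, Fintype.card_fin, nsmul_eq_mul,
    mul_assoc, Finset.sum_mul, ← Finset.mul_sum]
  rw [Finset.sum_comm, mul_add]
  field_simp

theorem gradient_hardFun (i : Fin n) (x : E d) :
    gradient (hardFun n d μ a β q i) x = chainGrad μ a (chainWeight n d β q (i % 2)) x :=
  (hasGradientAt_chainQuad μ a _ x).gradient

theorem gradient_hardFun_mem (i : Fin n) {k : ℕ} {x : E d} (hx : x ∈ prefixSpace d k) :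
    gradient (hardFun n d μ a β q i) x ∈ prefixSpace d (reach (i % 2) k) := by
  rw [gradient_hardFun]
  exact chainGrad_mem (fun j hj => if_neg hj) hx

theorem shiftExt_hardMin {j : ℕ} (hj : j ≤ d) :
    shiftExt (hardMin d a q) j + (if j = 0 then a else 0) = a * q ^ j := by
  rcases j with _ | k
  · simp [shiftExt_zero]
  · simp [shiftExt_succ _ hj, hardMin]

theorem linkWeight_mul_chainLink_hardMin {j : ℕ} (hj : j ≤ d) :
    linkWeight d β q j * chainLink a (hardMin d a q) j = β * (a * (1 - q)) * q ^ j := by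
  have hlink : chainLink a (hardMin d a q) j = a * q ^ j - shiftExt (hardMin d a q) (j + 1) := by
    rw [chainLink, inner_linkVec, ← shiftExt_hardMin hj]
    ring
  rw [hlink, linkWeight]
  rcases hj.eq_or_lt with rfl | hjd
  · rw [if_pos rfl, shiftExt_succ_of_le _ le_rfl]
    ring
  · rw [if_neg hjd.ne, shiftExt_succ _ hjd, hardMin]
    ring

theorem chainGrad_hardMin (hq : μ * q = β * (1 - q) ^ 2) :
    chainGrad μ a (linkWeight d β q) (hardMin d a q) = 0 := by
  have hlinks : ∀ j ∈ Finset.range (d + 1),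
      (linkWeight d β q j * chainLink a (hardMin d a q) j) • linkVec d j =
        (β * (a * (1 - q)) * q ^ j) • linkVec d j := fun j hj => by
    rw [linkWeight_mul_chainLink_hardMin (Finset.mem_range_succ_iff.mp hj)]
  rw [chainGrad, Finset.sum_congr rfl hlinks]
  ext k
  have hk := k.isLt
  rw [PiLp.add_apply, WithLp.ofLp_sum, Finset.sum_apply]
  simp only [PiLp.smul_apply, linkVec, hardMin, smul_eq_mul, mul_sub, mul_ite, mul_one, mul_zero,
    Finset.sum_sub_distrib, Finset.sum_ite_eq, PiLp.zero_apply]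
  rw [if_pos (Finset.mem_range.mpr (by omega)), if_pos (Finset.mem_range.mpr (by omega))]
  linear_combination a * q ^ (k : ℕ) * hq

theorem le_avg_hardFun_sub (hn : 2 ≤ n) (hβ : 0 ≤ β) (hq1 : q ≤ 1)
    (hq : μ * q = β * (1 - q) ^ 2) (y : E d) :
    μ / 2 * ‖y - hardMin d a q‖ ^ 2 ≤
      avg (hardFun n d μ a β q) y - avg (hardFun n d μ a β q) (hardMin d a q) := by
  simpa [chainGrad_hardMin hq, avg_hardFun hn] using
    chainQuad_lower (μ := μ) (a := a) (linkWeight_nonneg (d := d) hβ hq1) (hardMin d a q) y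

theorem avg_hardFun_hardMin_le (hn : 2 ≤ n) (hμ : 0 ≤ μ) (hβ : 0 ≤ β) (hq1 : q ≤ 1)
    (hq : μ * q = β * (1 - q) ^ 2) (y : E d) :
    avg (hardFun n d μ a β q) (hardMin d a q) ≤ avg (hardFun n d μ a β q) y :=
  sub_nonneg.mp ((by positivity : (0 : ℝ) ≤ μ / 2 * ‖y - hardMin d a q‖ ^ 2).trans
    (le_avg_hardFun_sub hn hβ hq1 hq y))

theorem hardMin_apply_sq (hΔ : (a * q) ^ 2 = Δ * (1 - q ^ 2)) (k : Fin d) :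
    hardMin d a q k ^ 2 = Δ * (1 - q ^ 2) * (q ^ 2) ^ (k : ℕ) := by
  rw [← hΔ, hardMin]
  ring

theorem norm_hardMin_sq_le (hΔ0 : 0 ≤ Δ) (hΔ : (a * q) ^ 2 = Δ * (1 - q ^ 2)) :
    ‖hardMin d a q‖ ^ 2 ≤ Δ := by
  calc ‖hardMin d a q‖ ^ 2 = Δ * (1 - (q ^ 2) ^ d) := by
        rw [EuclideanSpace.real_norm_sq_eq, ← mul_neg_geom_sum, ← mul_assoc, Finset.mul_sum,
          Finset.sum_range]
        exact Finset.sum_congr rfl fun k _ => hardMin_apply_sq hΔ k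
    _ ≤ Δ := mul_le_of_le_one_right hΔ0 (sub_le_self 1 (by positivity))

theorem inClass_hardFun {L : ℝ} (hn : 2 ≤ n) (hμ : 0 ≤ μ) (hβ : 0 ≤ β) (hL : μ + 6 * β ≤ L)
    (hq0 : 0 ≤ q) (hq1 : q ≤ 1) (hq : μ * q = β * (1 - q) ^ 2) (hΔ0 : 0 ≤ Δ)
    (hΔ : (a * q) ^ 2 = Δ * (1 - q ^ 2)) : InClass L μ Δ (hardFun n d μ a β q) where
  differentiable _ x := (hasGradientAt_chainQuad μ a _ x).differentiableAt
  strong_convex i x y := by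
    rw [gradient_hardFun]
    exact chainQuad_lower (chainWeight_nonneg hβ hq1 _) x y
  smooth i x y := by
    rw [gradient_hardFun]
    refine (chainQuad_upper (by positivity)
      (chainWeight_le hn hβ hq0 hq1 (Nat.mod_lt i two_pos)) x y).trans ?_
    gcongr
    linarith
  minimizer := ⟨hardMin d a q, avg_hardFun_hardMin_le hn hμ hβ hq1 hq, by
    rw [zero_sub, norm_neg]
    exact norm_hardMin_sq_le hΔ0 hΔ⟩

theorem pow_sub_pow_le_mul_sum_ite {φ : ℝ} (h0 : 0 ≤ φ) (h1 : φ ≤ 1) (k N : ℕ) :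
    φ ^ k - φ ^ N ≤ (1 - φ) * ∑ j ∈ Finset.range N, if k ≤ j then φ ^ j else 0 := by
  rcases le_total k N with hkN | hNk
  · have hset : (Finset.range N).filter (k ≤ ·) = Finset.Ico k N := by
      ext j
      simp [and_comm]
    rw [← Finset.sum_filter, hset, mul_comm, geom_sum_Ico_mul_neg φ hkN]
  · refine (sub_nonpos.mpr (pow_le_pow_of_le_one h0 h1 hNk)).trans
      (mul_nonneg (sub_nonneg.mpr h1) (Finset.sum_nonneg fun j _ => ?_))
    split_ifs <;> positivity

theorem le_norm_sub_hardMin_sq (hq0 : 0 ≤ q) (hq1 : q ≤ 1) (hΔ0 : 0 ≤ Δ)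
    (hΔ : (a * q) ^ 2 = Δ * (1 - q ^ 2)) {k : ℕ} {y : E d} (hy : y ∈ prefixSpace d k) :
    Δ * ((q ^ 2) ^ k - (q ^ 2) ^ d) ≤ ‖y - hardMin d a q‖ ^ 2 := by
  calc Δ * ((q ^ 2) ^ k - (q ^ 2) ^ d)
      ≤ Δ * ((1 - q ^ 2) * ∑ j ∈ Finset.range d, if k ≤ j then (q ^ 2) ^ j else 0) := by
        gcongr
        exact pow_sub_pow_le_mul_sum_ite (sq_nonneg q) (pow_le_one₀ hq0 hq1) k d
    _ ≤ ‖y - hardMin d a q‖ ^ 2 := by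
        rw [EuclideanSpace.real_norm_sq_eq, ← mul_assoc, Finset.mul_sum, Finset.sum_range]
        refine Finset.sum_le_sum fun j _ => ?_
        split_ifs with h
        · rw [PiLp.sub_apply, hy j h, zero_sub, neg_sq, hardMin_apply_sq hΔ]
        · rw [mul_zero]
          positivity

theorem le_avg_hardFun_sub_iInf (hn : 2 ≤ n) (hμ : 0 ≤ μ) (hβ : 0 ≤ β) (hq0 : 0 ≤ q) (hq1 : q ≤ 1)
    (hq : μ * q = β * (1 - q) ^ 2) (hΔ0 : 0 ≤ Δ) (hΔ : (a * q) ^ 2 = Δ * (1 - q ^ 2)) {k : ℕ}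
    {y : E d} (hy : y ∈ prefixSpace d k) :
    μ * Δ / 2 * ((q ^ 2) ^ k - (q ^ 2) ^ d) ≤
      avg (hardFun n d μ a β q) y - ⨅ x, avg (hardFun n d μ a β q) x := by
  rw [iInf_avg_eq (avg_hardFun_hardMin_le hn hμ hβ hq1 hq), mul_div_right_comm, mul_assoc]
  exact (mul_le_mul_of_nonneg_left (le_norm_sub_hardMin_sq hq0 hq1 hΔ0 hΔ hy)
    (by positivity)).trans (le_avg_hardFun_sub hn hβ hq1 hq y)

end HardInstance

/-! ### Progress of the algorithms under random sparsification -/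

section Confinement

variable {n d m : ℕ} {f : Fin n → E d → ℝ} {C : CompressorFamily.{u} n d} {A : Algorithm.{v} n d}
  {c : A.Coin} {t k : ℕ}

/-- Each worker can extend its prefix of known coordinates only by the links of its own parity: the
gradient of `f_i` at a vector of prefix `k` has prefix `reach (i % 2) k`. -/
def IsParityChain (f : Fin n → E d → ℝ) : Prop :=
  ∀ (i : Fin n) k x, x ∈ prefixSpace d k → gradient (f i) x ∈ prefixSpace d (reach (i % 2) k)

/-- The state of a run before round `t`: everything exchanged has prefix `k`, and worker `i` has
queried nothing beyond what it reaches from there with the links of its own parity. -/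
structure Confined (A : Algorithm.{v} n d) (f : Fin n → E d → ℝ) (C : CompressorFamily.{u} n d)
    (c : A.Coin) (ξ : ℕ → C.Seed) (t k : ℕ) : Prop where
  sent_mem : ∀ r < t, A.sent f C c ξ r ∈ prefixSpace d k
  recv_mem : ∀ r < t, ∀ i, A.recv f C c ξ r i ∈ prefixSpace d k
  query_mem : ∀ r < t, ∀ i, ∀ y ∈ A.queries f C c ξ r i, y ∈ prefixSpace d (reach (i % 2) k)

theorem IsParityChain.gradient_mem (hf : IsParityChain f) {i : Fin n} {x : E d}
    (hx : x ∈ prefixSpace d (reach (i % 2) k)) :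
    gradient (f i) x ∈ prefixSpace d (reach (i % 2) k) := by
  simpa only [reach_reach] using hf i _ x hx

theorem prefixSpace_le_reach (p : ℕ) : prefixSpace d k ≤ prefixSpace d (reach p k) :=
  prefixSpace_mono (le_reach p k)

namespace Confined

variable {ξ : ℕ → C.Seed}

theorem mono {l : ℕ} (h : Confined A f C c ξ t k) (hkl : k ≤ l) : Confined A f C c ξ t l where
  sent_mem r hr := prefixSpace_mono hkl (h.sent_mem r hr)
  recv_mem r hr i := prefixSpace_mono hkl (h.recv_mem r hr i)
  query_mem r hr i y hy := prefixSpace_mono (reach_mono _ hkl) (h.query_mem r hr i y hy)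

theorem out_mem (h : Confined A f C c ξ t k) (hA : A.LinearSpanning f C) :
    A.out f C c ξ t ∈ prefixSpace d k := by
  refine Submodule.span_le.mpr ?_ (hA.out_mem c ξ t)
  rintro _ (⟨r, hr, rfl⟩ | ⟨r, hr, i, rfl⟩)
  · exact h.sent_mem r hr
  · exact h.recv_mem r hr i

theorem sent_mem_of_le (h : Confined A f C c ξ t k) (hA : A.LinearSpanning f C) {r : ℕ}
    (hr : r ≤ t) : A.sent f C c ξ r ∈ prefixSpace d k := by
  rcases hr.eq_or_lt with rfl | hr
  · refine Submodule.span_le.mpr ?_ (hA.sent_mem c ξ r)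
    rintro _ (⟨s, hs, rfl⟩ | ⟨s, hs, i, rfl⟩)
    · exact h.sent_mem s hs
    · exact h.recv_mem s hs i
  · exact h.sent_mem r hr

theorem query_mem_of_le (h : Confined A f C c ξ t k) (hA : A.LinearSpanning f C)
    (hf : IsParityChain f) {r : ℕ} (hr : r ≤ t) (i : Fin n) {y : E d}
    (hy : y ∈ A.queries f C c ξ r i) : y ∈ prefixSpace d (reach (i % 2) k) := by
  rcases hr.eq_or_lt with rfl | hr
  · refine Submodule.span_le.mpr ?_ (hA.queries_subset c ξ r i hy)
    rintro _ ((⟨s, hs, rfl⟩ | ⟨s, hs, z, hz, rfl⟩) | ⟨s, hs, rfl⟩)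
    · exact prefixSpace_le_reach _ (h.sent_mem_of_le hA hs)
    · exact hf.gradient_mem (h.query_mem s hs i z hz)
    · exact prefixSpace_le_reach _ (h.recv_mem s hs i)
  · exact h.query_mem r hr i y hy

theorem msg_mem (h : Confined A f C c ξ t k) (hA : A.LinearSpanning f C) (hf : IsParityChain f)
    (i : Fin n) : A.msg f C c ξ t i ∈ prefixSpace d (reach (i % 2) k) := by
  refine Submodule.span_le.mpr ?_ (hA.msg_mem c ξ t i)
  rintro _ ((⟨s, hs, rfl⟩ | ⟨s, hs, z, hz, rfl⟩) | ⟨s, hs, rfl⟩)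
  · exact prefixSpace_le_reach _ (h.sent_mem_of_le hA hs)
  · exact hf.gradient_mem (h.query_mem_of_le hA hf hs i hz)
  · exact prefixSpace_le_reach _ (h.recv_mem s hs i)

theorem succ (h : Confined A f C c ξ t k) (hA : A.LinearSpanning f C) (hf : IsParityChain f)
    {l : ℕ} (hkl : k ≤ l) (hl : ∀ i, A.recv f C c ξ t i ∈ prefixSpace d l) :
    Confined A f C c ξ (t + 1) l where
  sent_mem r hr := prefixSpace_mono hkl (h.sent_mem_of_le hA (Nat.lt_succ_iff.mp hr))
  recv_mem r hr i := by
    rcases (Nat.lt_succ_iff.mp hr).eq_or_lt with rfl | hr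
    · exact hl i
    · exact (h.mono hkl).recv_mem r hr i
  query_mem r hr i y hy := prefixSpace_mono (reach_mono _ hkl)
    (h.query_mem_of_le hA hf (Nat.lt_succ_iff.mp hr) i hy)

end Confined

theorem recv_eq_compress_msg (A : Algorithm.{v} n d) (f : Fin n → E d → ℝ)
    (C : CompressorFamily.{u} n d) (c : A.Coin) (ξ : ℕ → C.Seed) (t : ℕ) (i : Fin n) :
    A.recv f C c ξ t i = C.compress i (ξ t) (A.msg f C c ξ t i) := by
  rw [Algorithm.recv]
  rfl

/-- The number of coordinates that the server can have reached after `t` rounds: one more in each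
round in which the residue class of the next coordinate is drawn. -/
def progress {m : ℕ} (ξ : ℕ → Fin m) : ℕ → ℕ
  | 0 => 0
  | t + 1 => if progress ξ t % m = ξ t then progress ξ t + 1 else progress ξ t

theorem progress_le_succ (ξ : ℕ → Fin m) (t : ℕ) : progress ξ t ≤ progress ξ (t + 1) := by
  rw [progress]
  split_ifs <;> omega

theorem keepClass_mem {s : Fin m} {p : ℕ} {x : E d} (hx : x ∈ prefixSpace d (reach p k)) :
    keepClass s x ∈ prefixSpace d (if k % m = s then k + 1 else k) := by
  intro j hj
  simp only [keepClass]
  split_ifs at hj with h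
  · rw [hx j ((reach_le p k).trans hj), mul_zero, ite_self]
  · rcases hj.eq_or_lt with hjk | hjk
    · rw [if_neg (hjk ▸ h)]
    · rw [hx j ((reach_le p k).trans hjk), mul_zero, ite_self]

theorem confined_progress [NeZero m] (hf : IsParityChain f)
    (hA : A.LinearSpanning f (classSparsifier n d m)) (c : A.Coin) (ξ : ℕ → Fin m) (t : ℕ) :
    Confined A f (classSparsifier n d m) c ξ t (progress ξ t) := by
  induction t with
  | zero =>
    exact ⟨fun _ h => absurd h (by omega), fun _ h => absurd h (by omega),
      fun _ h => absurd h (by omega)⟩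
  | succ t ih =>
    refine ih.succ hA hf (progress_le_succ ξ t) fun i => ?_
    have hrecv := recv_eq_compress_msg A f (classSparsifier n d m) c ξ t i
    rw [hrecv]
    exact keepClass_mem (ih.msg_mem hA hf i)

end Confinement

section Expectation

variable {m : ℕ}

theorem progress_congr {ξ ξ' : ℕ → Fin m} (t : ℕ) (h : ∀ r < t, ξ r = ξ' r) :
    progress ξ t = progress ξ' t := by
  induction t with
  | zero => rfl
  | succ t ih => rw [progress, progress, ih fun r hr => h r (by omega), h t (by omega)]

variable [NeZero m]

theorem exists_progress_eq_restrict (m t : ℕ) [NeZero m] :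
    ∃ F : (Finset.range t → Fin m) → ℕ, ∀ ξ : ℕ → Fin m, progress ξ t = F fun i => ξ i := by
  refine ⟨fun v => progress (fun r => if hr : r ∈ Finset.range t then v ⟨r, hr⟩ else 0) t,
    fun ξ => progress_congr t fun r hr => ?_⟩
  rw [dif_pos (Finset.mem_range.mpr hr)]

theorem measurable_progress (t : ℕ) : Measurable fun ξ : ℕ → Fin m => progress ξ t := by
  obtain ⟨F, hF⟩ := exists_progress_eq_restrict m t
  simp_rw [hF]
  exact (measurable_of_finite F).comp (by fun_prop)

/-- The law of a sequence of independent uniform residue classes, that is, of the seeds of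
`classSparsifier` in the successive rounds. -/
def seedLaw (m : ℕ) [NeZero m] : Measure (ℕ → Fin m) :=
  Measure.infinitePi fun _ : ℕ => (PMF.uniformOfFintype (Fin m)).toMeasure

instance : IsProbabilityMeasure (seedLaw m) := by unfold seedLaw; infer_instance

theorem indepFun_progress (t : ℕ) :
    ProbabilityTheory.IndepFun (fun ξ : ℕ → Fin m => progress ξ t) (fun ξ => ξ t) (seedLaw m) := by
  have hind : ProbabilityTheory.iIndepFun (fun (i : ℕ) (ξ : ℕ → Fin m) => ξ i) (seedLaw m) :=
    ProbabilityTheory.iIndepFun_infinitePi (X := fun _ s => s) fun _ => measurable_id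
  obtain ⟨F, hF⟩ := exists_progress_eq_restrict m t
  simp_rw [hF]
  exact (hind.indepFun_finset (Finset.range t) {t} (by simp) fun i => measurable_pi_apply i).comp
    (measurable_of_finite F)
    (measurable_pi_apply (⟨t, Finset.mem_singleton_self t⟩ : ({t} : Finset ℕ)))

theorem map_progress_seed (t : ℕ) :
    (seedLaw m).map (fun ξ => (progress ξ t, ξ t)) =
      ((seedLaw m).map fun ξ => progress ξ t).prod (PMF.uniformOfFintype (Fin m)).toMeasure := by
  rw [(indepFun_progress t).map_prod_eq_prod_map_map (measurable_progress t).aemeasurable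
    (measurable_pi_apply t).aemeasurable]
  congr 1
  exact Measure.infinitePi_map_eval _ t

theorem integrable_pow_nat {φ : ℝ} (h0 : 0 ≤ φ) (h1 : φ ≤ 1) {α : Type*} [MeasurableSpace α]
    {P : Measure α} [IsFiniteMeasure P] {K : α → ℕ} (hK : Measurable K) :
    Integrable (fun a => φ ^ K a) P := by
  refine Integrable.of_bound ((measurable_from_nat (f := fun k => φ ^ k)).comp
    hK).aestronglyMeasurable 1 (Filter.Eventually.of_forall fun a => ?_)
  rw [Real.norm_eq_abs, abs_of_nonneg (pow_nonneg h0 _)]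
  exact pow_le_one₀ h0 h1

theorem integral_pow_ite_mod_eq (φ : ℝ) (k : ℕ) :
    ∫ s : Fin m, φ ^ (if k % m = s then k + 1 else k) ∂(PMF.uniformOfFintype (Fin m)).toMeasure =
      (1 - (1 - φ) / m) * φ ^ k := by
  have hm0 : (m : ℝ) ≠ 0 := by exact_mod_cast NeZero.ne m
  have hsplit (s : Fin m) : φ ^ (if k % m = s then k + 1 else k) =
      φ ^ k - if k % m = s then (1 - φ) * φ ^ k else 0 := by
    split_ifs <;> ring
  simp_rw [integral_uniformOfFintype, hsplit, Finset.sum_sub_distrib, sum_ite_mod_eq]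
  rw [Finset.sum_const, Finset.card_univ, Fintype.card_fin, nsmul_eq_mul, smul_eq_mul]
  field_simp

theorem integral_pow_progress {φ : ℝ} (h0 : 0 ≤ φ) (h1 : φ ≤ 1) (t : ℕ) :
    ∫ ξ, φ ^ progress ξ t ∂seedLaw m = (1 - (1 - φ) / m) ^ t := by
  induction t with
  | zero => simp [progress]
  | succ t ih =>
    let next : ℕ × Fin m → ℕ := fun p => if p.1 % m = p.2 then p.1 + 1 else p.1
    have hnext : Measurable next :=
      measurable_from_prod_countable_left fun s => measurable_from_nat
    have hpow : Measurable fun k : ℕ => φ ^ k := measurable_from_nat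
    have : IsProbabilityMeasure ((seedLaw m).map fun ξ => progress ξ t) :=
      Measure.isProbabilityMeasure_map (measurable_progress t).aemeasurable
    calc ∫ ξ, φ ^ progress ξ (t + 1) ∂seedLaw m
        = ∫ p, φ ^ next p ∂((seedLaw m).map fun ξ => (progress ξ t, ξ t)) :=
          (integral_map ((measurable_progress t).prodMk (measurable_pi_apply t)).aemeasurable
            (hpow.comp hnext).aestronglyMeasurable).symm
      _ = ∫ k, ∫ s, φ ^ next (k, s) ∂(PMF.uniformOfFintype (Fin m)).toMeasure
            ∂((seedLaw m).map fun ξ => progress ξ t) := by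
          rw [map_progress_seed, integral_prod _ (integrable_pow_nat h0 h1 hnext)]
      _ = (1 - (1 - φ) / m) * ∫ k, φ ^ k ∂((seedLaw m).map fun ξ => progress ξ t) := by
          simp_rw [next, integral_pow_ite_mod_eq, integral_const_mul]
      _ = (1 - (1 - φ) / m) ^ (t + 1) := by
          rw [integral_map (measurable_progress t).aemeasurable hpow.aestronglyMeasurable, ih,
            pow_succ']

end Expectation

section Decay

variable {n d m : ℕ} [NeZero m] {f : Fin n → E d → ℝ} {A : Algorithm.{v} n d} {M φ : ℝ}

theorem lintegral_const_mul_pow_progress {α : Type*} [MeasurableSpace α] (P : Measure α)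
    [IsProbabilityMeasure P] (hM : 0 ≤ M) (h0 : 0 ≤ φ) (h1 : φ ≤ 1) (t : ℕ) :
    ∫⁻ p : α × (ℕ → Fin m), ENNReal.ofReal (M * φ ^ progress p.2 t) ∂(P.prod (seedLaw m)) =
      ENNReal.ofReal (M * (1 - (1 - φ) / m) ^ t) := by
  have hmeas : Measurable fun ξ : ℕ → Fin m => ENNReal.ofReal (M * φ ^ progress ξ t) :=
    (measurable_from_nat (f := fun k => ENNReal.ofReal (M * φ ^ k))).comp (measurable_progress t)
  rw [(measurePreserving_snd (μ := P) (ν := seedLaw m)).lintegral_comp hmeas,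
    ← ofReal_integral_eq_lintegral_ofReal
      ((integrable_pow_nat h0 h1 (measurable_progress t)).const_mul M)
      (Filter.Eventually.of_forall fun ξ => mul_nonneg hM (pow_nonneg h0 _)),
    integral_const_mul, integral_pow_progress h0 h1]

theorem ofReal_le_expectedGap_add (hM : 0 ≤ M) (h0 : 0 ≤ φ) (h1 : φ ≤ 1) (hf : IsParityChain f)
    (hgap : ∀ k x, x ∈ prefixSpace d k → M * (φ ^ k - φ ^ d) ≤ avg f x - ⨅ y, avg f y)
    (hA : A.LinearSpanning f (classSparsifier n d m)) (t : ℕ) :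
    ENNReal.ofReal (M * (1 - (1 - φ) / m) ^ t) ≤
      A.expectedGap f (classSparsifier n d m) t + ENNReal.ofReal (M * φ ^ d) := by
  rw [← lintegral_const_mul_pow_progress A.coinLaw hM h0 h1]
  calc ∫⁻ p, ENNReal.ofReal (M * φ ^ progress p.2 t) ∂(A.coinLaw.prod (seedLaw m))
      ≤ ∫⁻ p : A.Coin × (ℕ → Fin m),
          (ENNReal.ofReal (avg f (A.out f (classSparsifier n d m) p.1 p.2 t) - ⨅ y, avg f y) +
            ENNReal.ofReal (M * φ ^ d)) ∂(A.coinLaw.prod (seedLaw m)) := by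
        refine lintegral_mono fun p => ?_
        refine (ENNReal.ofReal_le_ofReal ?_).trans ENNReal.ofReal_add_le
        have := hgap _ _ ((confined_progress hf hA p.1 p.2 t).out_mem hA)
        linarith
    _ = A.expectedGap f (classSparsifier n d m) t + ENNReal.ofReal (M * φ ^ d) := by
        rw [lintegral_add_right _ measurable_const, lintegral_const, measure_univ, mul_one]
        rfl

theorem mul_pow_le_of_expectedGap_le {ε : ℝ} (hM : 0 ≤ M) (h0 : 0 ≤ φ) (h1 : φ ≤ 1) (hε : 0 ≤ ε)
    (hf : IsParityChain f)
    (hgap : ∀ k x, x ∈ prefixSpace d k → M * (φ ^ k - φ ^ d) ≤ avg f x - ⨅ y, avg f y)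
    (hA : A.LinearSpanning f (classSparsifier n d m)) {t : ℕ}
    (ht : A.expectedGap f (classSparsifier n d m) t ≤ ENNReal.ofReal ε) :
    M * (1 - (1 - φ) / m) ^ t ≤ ε + M * φ ^ d := by
  have hMd : 0 ≤ M * φ ^ d := mul_nonneg hM (pow_nonneg h0 _)
  rw [← ENNReal.ofReal_le_ofReal_iff (by positivity), ENNReal.ofReal_add hε hMd]
  exact (ofReal_le_expectedGap_add hM h0 h1 hf hgap hA t).trans (add_le_add_left ht _)

end Decay

/-! ### Lower bounds -/

theorem one_sub_exp_sq (w : ℝ) :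
    (1 - Real.exp (-2 * w)) ^ 2 = (2 * Real.sinh w) ^ 2 * Real.exp (-2 * w) := by
  have hinv : Real.exp w * Real.exp (-w) = 1 := by
    rw [← Real.exp_add, add_neg_cancel, Real.exp_zero]
  have hsq : Real.exp (-2 * w) = Real.exp (-w) ^ 2 := by
    rw [← Real.exp_nat_mul]
    congr 1
    push_cast
    ring
  rw [hsq, ← mul_pow, Real.sinh_eq, mul_div_cancel₀ _ two_ne_zero, sub_mul, hinv,
    sq (Real.exp (-w))]

theorem exists_one_sub_exp_sq_eq {θ : ℝ} (hθ : 0 < θ) :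
    ∃ w : ℝ, 0 < w ∧ w ≤ √θ / 2 ∧ (1 - Real.exp (-2 * w)) ^ 2 = θ * Real.exp (-2 * w) := by
  have hw : 0 < Real.arsinh (√θ / 2) := Real.arsinh_pos_iff.mpr (by positivity)
  refine ⟨Real.arsinh (√θ / 2), hw, ?_, ?_⟩
  · simpa only [Real.sinh_arsinh] using Real.self_le_sinh_iff.mpr hw.le
  · rw [one_sub_exp_sq, Real.sinh_arsinh, mul_div_cancel₀ _ two_ne_zero, Real.sq_sqrt hθ.le]

theorem exp_neg_div_le {m : ℝ} (hm : 1 ≤ m) (x : ℝ) :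
    Real.exp (-x / m) ≤ 1 - (1 - Real.exp (-x)) / m := by
  have hm0 : 0 < m := one_pos.trans_le hm
  have hbernoulli := rpow_one_add_le_one_add_mul_self (s := Real.exp (-x) - 1) (p := 1 / m)
    (by linarith [Real.exp_pos (-x)]) (by positivity) ((div_le_one hm0).mpr hm)
  rw [add_sub_cancel, ← Real.exp_mul, mul_one_div] at hbernoulli
  exact hbernoulli.trans_eq (by ring)

theorem mul_log_div_le_of_mul_pow_le {δ w ε m : ℝ} {t : ℕ} (hm : 1 ≤ m) (hw : 0 < w) (hε : 0 < ε)
    (hεδ : ε ≤ 1 / 16 * δ) (h : δ / 2 * (1 - (1 - Real.exp (-(4 * w))) / m) ^ t ≤ 2 * ε) :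
    m * Real.log (δ / ε) / (8 * w) ≤ t := by
  have hm0 : 0 < m := one_pos.trans_le hm
  have hδ : 0 < δ := by linarith
  have hexp : δ / ε ≤ 4 * Real.exp (4 * w / m * t) := by
    have hpow : Real.exp (-(4 * w / m * t)) ≤ (1 - (1 - Real.exp (-(4 * w))) / m) ^ t := by
      calc Real.exp (-(4 * w / m * t)) = Real.exp (-(4 * w) / m) ^ t := by
            rw [← Real.exp_nat_mul]
            ring_nf
        _ ≤ _ := pow_le_pow_left₀ (Real.exp_pos _).le (exp_neg_div_le hm _) t
    have := (mul_le_mul_of_nonneg_left hpow (by positivity : 0 ≤ δ / 2)).trans h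
    rw [Real.exp_neg, ← div_eq_mul_inv, div_le_iff₀ (Real.exp_pos _)] at this
    rw [div_le_iff₀ hε]
    linarith
  have hlog : Real.log (δ / ε) ≤ Real.log 4 + 4 * w / m * t := by
    rw [← Real.log_exp (4 * w / m * t), ← Real.log_mul (by norm_num) (Real.exp_pos _).ne']
    exact Real.log_le_log (by positivity) hexp
  have hlog4 : 2 * Real.log 4 ≤ Real.log (δ / ε) := by
    rw [← Nat.cast_two, ← Real.log_pow]
    refine Real.log_le_log (by norm_num) ?_
    rw [le_div_iff₀ hε]
    norm_num
    linarith
  have hhalf : Real.log (δ / ε) / 2 ≤ 4 * w * t / m := by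
    rw [mul_div_right_comm]
    linarith
  rw [le_div_iff₀ hm0] at hhalf
  rw [div_le_iff₀ (by positivity)]
  linarith

theorem le_rounds_classSparsifier {n d m : ℕ} [NeZero m] {f : Fin n → E d → ℝ} {δ w ε : ℝ}
    (hw : 0 < w) (hε : 0 < ε) (hεδ : ε ≤ 1 / 16 * δ) (hf : IsParityChain f)
    (hgap : ∀ k x, x ∈ prefixSpace d k →
      δ / 2 * (Real.exp (-(4 * w)) ^ k - Real.exp (-(4 * w)) ^ d) ≤ avg f x - ⨅ y, avg f y)
    (hd : δ / 2 * Real.exp (-(4 * w)) ^ d ≤ ε) {A : Algorithm.{v} n d}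
    (hA : A.LinearSpanning f (classSparsifier n d m)) :
    ENNReal.ofReal (m * Real.log (δ / ε) / (8 * w)) ≤
      (A.rounds f (classSparsifier n d m) ε : ℝ≥0∞) := by
  refine ofReal_le_iInf_natCast fun t ht => ?_
  have hdecay := mul_pow_le_of_expectedGap_le (by linarith) (Real.exp_pos _).le
    (Real.exp_le_one_iff.mpr (by linarith)) hε.le hf hgap hA ht
  exact mul_log_div_le_of_mul_pow_le (by exact_mod_cast NeZero.one_le) hw hε hεδ
    (hdecay.trans (by linarith))

theorem exists_isParityChain {L μ Δ : ℝ} (hμ : 0 < μ) (hμL : μ < L) (hΔ : 0 ≤ Δ) :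
    ∃ w : ℝ, 0 < w ∧ w ≤ √(6 * μ / (L - μ)) / 2 ∧ ∀ n d : ℕ, 2 ≤ n →
      ∃ f : Fin n → E d → ℝ, InClass L μ Δ f ∧ IsParityChain f ∧ ∀ k x, x ∈ prefixSpace d k →
        μ * Δ / 2 * (Real.exp (-(4 * w)) ^ k - Real.exp (-(4 * w)) ^ d) ≤
          avg f x - ⨅ y, avg f y := by
  have : 0 < L - μ := sub_pos.mpr hμL
  obtain ⟨w, hw, hwθ, hwq⟩ := exists_one_sub_exp_sq_eq (by positivity : 0 < 6 * μ / (L - μ))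
  refine ⟨w, hw, hwθ, fun n d hn => ?_⟩
  have hq0 : 0 < Real.exp (-2 * w) := Real.exp_pos _
  have hq1 : Real.exp (-2 * w) ≤ 1 := Real.exp_le_one_iff.mpr (by linarith)
  have hsq : Real.exp (-2 * w) ^ 2 = Real.exp (-(4 * w)) := by
    rw [← Real.exp_nat_mul]
    congr 1
    push_cast
    ring
  set q := Real.exp (-2 * w)
  set a := √(Δ * (1 - q ^ 2)) / q
  have hβ : 0 ≤ (L - μ) / 6 := by positivity
  have hq : μ * q = (L - μ) / 6 * (1 - q) ^ 2 := by
    rw [hwq]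
    field_simp
  have ha : (a * q) ^ 2 = Δ * (1 - q ^ 2) := by
    rw [div_mul_cancel₀ _ hq0.ne', Real.sq_sqrt]
    exact mul_nonneg hΔ (sub_nonneg.mpr (pow_le_one₀ hq0.le hq1))
  rw [← hsq]
  exact ⟨hardFun n d μ a ((L - μ) / 6) q,
    inClass_hardFun hn hμ.le hβ (by linarith) hq0.le hq1 hq hΔ ha,
    fun i k x hx => gradient_hardFun_mem i hx,
    fun k x hx => le_avg_hardFun_sub_iInf hn hμ.le hβ hq0.le hq1 hq hΔ ha hx⟩

/-- The instance `(f, C)` shows that `ω`-unbiased compressors can be cheap and yet force every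
linear-spanning algorithm to use at least `(1 + ω) B` rounds for the accuracy `ε`. -/
structure IsHardInstance {n d : ℕ} (ω ε B : ℝ) (f : Fin n → E d → ℝ)
    (C : CompressorFamily.{u} n d) : Prop where
  isUnbiased : C.IsUnbiased ω
  bitCost_eq : ∀ r i j, C.bitCost r i = C.bitCost r j
  perRoundCost_le : ∀ r : ℕ, 1 ≤ r → (C.perRoundCost r : ℝ≥0∞) ≤
    ENNReal.ofReal (12 * (d / (1 + ω)) * (r + Real.logb 2 (1 + ω)))
  le_rounds : ∀ A : Algorithm.{v} n d, A.LinearSpanning f C →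
    ENNReal.ofReal ((1 + ω) * B) ≤ (A.rounds f C ε : ℝ≥0∞)

namespace IsHardInstance

variable {n d r : ℕ} {ω ε c B : ℝ} {f : Fin n → E d → ℝ} {C : CompressorFamily.{u} n d}
  {A : Algorithm.{v} n d}

theorem mono (h : IsHardInstance.{u, v} ω ε B f C) {B' : ℝ} (hω : 0 ≤ ω) (hB : B' ≤ B) :
    IsHardInstance.{u, v} ω ε B' f C :=
  { h with
    le_rounds := fun A hA => (ENNReal.ofReal_le_ofReal (by gcongr)).trans (h.le_rounds A hA) }

theorem ofReal_const_mul_le_rounds (h : IsHardInstance.{u, v} ω ε (c * B) f C)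
    (hA : A.LinearSpanning f C) :
    ENNReal.ofReal (3 / 64 * c * ((1 + ω) * B)) ≤ (A.rounds f C ε : ℝ≥0∞) := by
  have hle : ENNReal.ofReal (3 / 64) ≤ 1 := ENNReal.ofReal_le_one.mpr (by norm_num)
  rw [mul_assoc, mul_left_comm c, ENNReal.ofReal_mul (by norm_num)]
  exact (mul_le_of_le_one_left' hle).trans (h.le_rounds A hA)

theorem ofReal_const_mul_le_tcc (h : IsHardInstance.{u, v} ω ε (c * B) f C) (hn : 1 ≤ n)
    (hω : 0 ≤ ω) (hr : 1 ≤ r) (hA : A.LinearSpanning f C) :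
    ENNReal.ofReal (3 / 64 * c * (d * B)) ≤ A.tcc f C r ε := by
  have hcost : ENNReal.ofReal (3 / 64 * (d / (1 + ω))) ≤ (C.perRoundCost r : ℝ≥0∞) :=
    (h.isUnbiased.le_bitCost hω hr ⟨0, hn⟩).trans
      (ENat.toENNReal_le.mpr (le_iSup (C.bitCost r) ⟨0, hn⟩))
  have hω0 : 1 + ω ≠ 0 := by positivity
  calc ENNReal.ofReal (3 / 64 * c * (d * B))
      = ENNReal.ofReal (3 / 64 * (d / (1 + ω))) * ENNReal.ofReal ((1 + ω) * (c * B)) := by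
        rw [← ENNReal.ofReal_mul (by positivity)]
        congr 1
        field_simp
    _ ≤ A.tcc f C r ε := mul_le_mul' hcost (h.le_rounds A hA)

end IsHardInstance

theorem exists_nat_le_and_le_two_mul {x : ℝ} (hx : 1 ≤ x) :
    ∃ m : ℕ, NeZero m ∧ (m : ℝ) ≤ x ∧ x ≤ 2 * m := by
  have hfloor : 1 ≤ ⌊x⌋₊ := Nat.one_le_floor_iff x |>.mpr hx
  have hfloor' : (1 : ℝ) ≤ ⌊x⌋₊ := by exact_mod_cast hfloor
  exact ⟨⌊x⌋₊, ⟨by omega⟩, Nat.floor_le (by linarith), by linarith [Nat.lt_floor_add_one x]⟩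

theorem exists_isHardInstance_of_lt {L μ Δ ω ε : ℝ} (hμ : 0 < μ) (hμL : μ < L) (hΔ : 0 ≤ Δ)
    (hω : 0 ≤ ω) (hε : 0 < ε) (hεΔ : ε ≤ 1 / 16 * (μ * Δ)) :
    ∃ d₀ : ℕ, ∀ d : ℕ, d₀ ≤ d → ∀ n : ℕ, 2 ≤ n →
      ∃ (f : Fin n → E d → ℝ) (C : CompressorFamily.{0} n d), InClass L μ Δ f ∧
        IsHardInstance.{0, v} ω ε
          (Real.log (μ * Δ / ε) / (8 * √(6 * μ / (L - μ)))) f C := by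
  obtain ⟨w, hw, hwθ, hf⟩ := exists_isParityChain hμ hμL hΔ
  obtain ⟨m, hm0, hmω, hωm⟩ := exists_nat_le_and_le_two_mul (by linarith : 1 ≤ 1 + ω)
  have htail : ∀ᶠ d : ℕ in Filter.atTop, μ * Δ / 2 * Real.exp (-(4 * w)) ^ d ≤ ε := by
    have := (tendsto_pow_atTop_nhds_zero_of_lt_one (Real.exp_pos (-(4 * w))).le
      (Real.exp_lt_one_iff.mpr (by linarith))).const_mul (μ * Δ / 2)
    rw [mul_zero] at this
    exact this.eventually_le_const hε
  obtain ⟨d₀, hd₀⟩ := Filter.eventually_atTop.mp (htail.and (Filter.eventually_ge_atTop m))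
  refine ⟨d₀, fun d hd n hn => ?_⟩
  obtain ⟨f, hfclass, hfchain, hgap⟩ := hf n d hn
  have hlog : 0 ≤ Real.log (μ * Δ / ε) :=
    Real.log_nonneg ((le_div_iff₀ hε).mpr (by linarith))
  refine ⟨f, classSparsifier n d m, hfclass, isUnbiased_classSparsifier hmω, fun _ _ _ => rfl,
    fun r hr => perRoundCost_classSparsifier_le hr hmω hωm (hd₀ d hd).2, fun A hA => ?_⟩
  refine (ENNReal.ofReal_le_ofReal ?_).trans
    (le_rounds_classSparsifier hw hε hεΔ hfchain hgap (hd₀ d hd).1 hA)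
  calc (1 + ω) * (Real.log (μ * Δ / ε) / (8 * √(6 * μ / (L - μ))))
      ≤ 2 * m * (Real.log (μ * Δ / ε) / (8 * (2 * w))) := by
        gcongr
        linarith
    _ = m * Real.log (μ * Δ / ε) / (8 * w) := by
        field_simp

theorem exists_isHardInstance {κ₀ : ℝ} (hκ₀ : 1 < κ₀) : ∃ c : ℝ, 0 < c ∧
    ∀ L μ Δ ω ε : ℝ, 0 < μ → κ₀ * μ ≤ L → 0 ≤ Δ → 0 ≤ ω → 0 < ε → ε ≤ 1 / 16 * (μ * Δ) →
    ∃ d₀ : ℕ, ∀ d : ℕ, d₀ ≤ d → ∀ n : ℕ, 2 ≤ n →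
      ∃ (f : Fin n → E d → ℝ) (C : CompressorFamily.{0} n d), InClass L μ Δ f ∧
        IsHardInstance.{0, v} ω ε (c * (√(L / μ) * Real.log (μ * Δ / ε))) f C := by
  have hκ₀' : 0 < κ₀ - 1 := sub_pos.mpr hκ₀
  refine ⟨1 / (8 * √(6 * κ₀ / (κ₀ - 1))), by positivity, fun L μ Δ ω ε hμ hL hΔ hω hε hεΔ => ?_⟩
  have hμL : μ < L := by nlinarith
  have : 0 < L - μ := sub_pos.mpr hμL
  obtain ⟨d₀, h⟩ := exists_isHardInstance_of_lt.{v} hμ hμL hΔ hω hε hεΔ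
  refine ⟨d₀, fun d hd n hn => ?_⟩
  obtain ⟨f, C, hf, hC⟩ := h d hd n hn
  refine ⟨f, C, hf, hC.mono hω ?_⟩
  have hlog : 0 ≤ Real.log (μ * Δ / ε) :=
    Real.log_nonneg ((le_div_iff₀ hε).mpr (by linarith))
  have hratio : √(6 * μ / (L - μ)) * √(L / μ) ≤ √(6 * κ₀ / (κ₀ - 1)) := by
    rw [← Real.sqrt_mul (by positivity)]
    refine Real.sqrt_le_sqrt ?_
    rw [div_mul_div_comm, div_le_div_iff₀ (by positivity) hκ₀']
    nlinarith
  rw [one_div_mul_eq_div, div_le_div_iff₀ (by positivity) (by positivity)]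
  calc √(L / μ) * Real.log (μ * Δ / ε) * (8 * √(6 * μ / (L - μ)))
      = Real.log (μ * Δ / ε) * (8 * (√(6 * μ / (L - μ)) * √(L / μ))) := by ring
    _ ≤ Real.log (μ * Δ / ε) * (8 * √(6 * κ₀ / (κ₀ - 1))) := by gcongr

theorem InClass.of_nonneg {n d : ℕ} {L μ Δ : ℝ} (hμ : 0 ≤ μ) {f : Fin n → E d → ℝ}
    (h : InClass L μ Δ f) : InClass L 0 Δ f :=
  { h with
    strong_convex := fun i x y => le_trans (by gcongr) (h.strong_convex i x y) }

-- The strongly convex instance with parameter `16 ε / Δ`, the least one for which `ε` is an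
-- admissible accuracy.
theorem exists_isHardInstance_zero : ∃ c : ℝ, 0 < c ∧
    ∀ L Δ ω ε : ℝ, 0 < Δ → 0 ≤ ω → 0 < ε → ε ≤ 1 / 32 * (L * Δ) →
    ∃ d₀ : ℕ, ∀ d : ℕ, d₀ ≤ d → ∀ n : ℕ, 2 ≤ n →
      ∃ (f : Fin n → E d → ℝ) (C : CompressorFamily.{0} n d), InClass L 0 Δ f ∧
        IsHardInstance.{0, v} ω ε (c * √(L * Δ / ε)) f C := by
  obtain ⟨c, hc, h⟩ := exists_isHardInstance.{v} one_lt_two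
  have : 0 < Real.log 16 := Real.log_pos (by norm_num)
  refine ⟨c * (Real.log 16 / 4), by positivity, fun L Δ ω ε hΔ hω hε hεΔ => ?_⟩
  have hμ : 0 < 16 * ε / Δ := by positivity
  have hμΔ : 16 * ε / Δ * Δ = 16 * ε := div_mul_cancel₀ _ hΔ.ne'
  have hμL : 2 * (16 * ε / Δ) ≤ L := by
    rw [← mul_div_assoc, div_le_iff₀ hΔ]
    linarith
  obtain ⟨d₀, hd₀⟩ := h L (16 * ε / Δ) Δ ω ε hμ hμL hΔ.le hω hε (by rw [hμΔ]; linarith)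
  refine ⟨d₀, fun d hd n hn => ?_⟩
  obtain ⟨f, C, hf, hC⟩ := hd₀ d hd n hn
  refine ⟨f, C, hf.of_nonneg hμ.le, hC.mono hω (le_of_eq ?_)⟩
  have hsqrt : √(L / (16 * ε / Δ)) = √(L * Δ / ε) / 4 := by
    rw [show L / (16 * ε / Δ) = L * Δ / ε / 4 ^ 2 by field_simp; norm_num,
      Real.sqrt_div' _ (by norm_num), Real.sqrt_sq (by norm_num)]
  rw [hsqrt, hμΔ, mul_div_cancel_right₀ _ hε.ne']
  ring

end DistOpt

end

theorem theorem1 :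
    -- every `ω`-unbiased compressor costs `Ω(d/(1+ω))` bits per round
    (∃ c : ℝ, 0 < c ∧
      ∀ (n d r : ℕ) (ω : ℝ), 1 ≤ r → 0 ≤ ω →
      ∀ C : DistOpt.CompressorFamily.{u} n d, C.IsUnbiased ω →
      ∀ i, ENNReal.ofReal (c * (d / (1 + ω))) ≤ (C.bitCost r i : ℝ≥0∞)) ∧
    -- strongly convex case: lower bound for all algorithms with `ω`-unbiased compression
    (∀ κ₀ : ℝ, 1 < κ₀ → ∃ c c₀ K : ℝ, 0 < c ∧ 0 < c₀ ∧ 0 < K ∧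
      ∀ L μ Δ ω ε : ℝ, 0 < μ → κ₀ * μ ≤ L → 0 < Δ → 0 ≤ ω → 0 < ε → ε ≤ c₀ * (μ * Δ) →
      ∃ d₀ : ℕ, ∀ d : ℕ, d₀ ≤ d → ∀ n : ℕ, 2 ≤ n →
      ∃ (f : Fin n → DistOpt.E d → ℝ) (C : DistOpt.CompressorFamily.{0} n d),
        DistOpt.InClass L μ Δ f ∧ C.IsUnbiased ω ∧
        (∀ r : ℕ, 1 ≤ r → (∀ i j, C.bitCost r i = C.bitCost r j) ∧
          (C.perRoundCost r : ℝ≥0∞) ≤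
            ENNReal.ofReal (K * (d / (1 + ω)) * (r + Real.logb 2 (1 + ω)))) ∧
        ∀ A : DistOpt.Algorithm.{v} n d, A.LinearSpanning f C →
          ENNReal.ofReal (c * ((1 + ω) * √(L / μ) * Real.log (μ * Δ / ε))) ≤
            (A.rounds f C ε : ℝ≥0∞) ∧
          ∀ r : ℕ, 1 ≤ r →
            ENNReal.ofReal (c * (d * (√(L / μ) * Real.log (μ * Δ / ε)))) ≤ A.tcc f C r ε) ∧
    -- generally convex case: lower bound for all algorithms with `ω`-unbiased compression
    (∃ c c₀ K : ℝ, 0 < c ∧ 0 < c₀ ∧ 0 < K ∧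
      ∀ L Δ ω ε : ℝ, 0 < L → 0 < Δ → 0 ≤ ω → 0 < ε → ε ≤ c₀ * (L * Δ) →
      ∃ d₀ : ℕ, ∀ d : ℕ, d₀ ≤ d → ∀ n : ℕ, 2 ≤ n →
      ∃ (f : Fin n → DistOpt.E d → ℝ) (C : DistOpt.CompressorFamily.{0} n d),
        DistOpt.InClass L 0 Δ f ∧ C.IsUnbiased ω ∧
        (∀ r : ℕ, 1 ≤ r → (∀ i j, C.bitCost r i = C.bitCost r j) ∧
          (C.perRoundCost r : ℝ≥0∞) ≤
            ENNReal.ofReal (K * (d / (1 + ω)) * (r + Real.logb 2 (1 + ω)))) ∧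
        ∀ A : DistOpt.Algorithm.{v} n d, A.LinearSpanning f C →
          ENNReal.ofReal (c * ((1 + ω) * √(L * Δ / ε))) ≤ (A.rounds f C ε : ℝ≥0∞) ∧
          ∀ r : ℕ, 1 ≤ r →
            ENNReal.ofReal (c * (d * √(L * Δ / ε))) ≤ A.tcc f C r ε) ∧
    -- the same orders are attained without compression, which is `ω`-unbiased for all `ω ≥ 0`
    (∀ (n d : ℕ) (ω : ℝ), 0 ≤ ω → (DistOpt.noCompression n d).IsUnbiased ω) ∧
    (∃ c₀ K : ℝ, 0 < c₀ ∧ 0 < K ∧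
      (∀ (n d : ℕ) (L μ : ℝ), 1 ≤ n → 0 < μ → μ ≤ L →
        ∃ A : DistOpt.Algorithm.{0} n d, ∀ (Δ : ℝ) (f : Fin n → DistOpt.E d → ℝ),
          DistOpt.InClass L μ Δ f →
          A.LinearSpanning f (DistOpt.noCompression n d) ∧
          ∀ (ε : ℝ) (r : ℕ), 0 < ε → ε ≤ c₀ * (μ * Δ) → 1 ≤ r →
            A.tcc f (DistOpt.noCompression n d) r ε ≤
              ENNReal.ofReal (K * (r * d * (√(L / μ) * Real.log (μ * Δ / ε))))) ∧
      (∀ (n d : ℕ) (L : ℝ), 1 ≤ n → 0 < L →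
        ∃ A : DistOpt.Algorithm.{0} n d, ∀ (Δ : ℝ) (f : Fin n → DistOpt.E d → ℝ),
          DistOpt.InClass L 0 Δ f →
          A.LinearSpanning f (DistOpt.noCompression n d) ∧
          ∀ (ε : ℝ) (r : ℕ), 0 < ε → ε ≤ c₀ * (L * Δ) → 1 ≤ r →
            A.tcc f (DistOpt.noCompression n d) r ε ≤
              ENNReal.ofReal (K * (r * d * √(L * Δ / ε))))) := by
  refine ⟨⟨3 / 64, by norm_num, fun n d r ω hr hω C hC i => hC.le_bitCost hω hr i⟩,
    fun κ₀ hκ₀ => ?_, ?_, fun n d ω hω => DistOpt.isUnbiased_noCompression n d hω,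
    Real.exp (-1), 8, Real.exp_pos _, by norm_num, fun n d L μ hn hμ hL => ?_,
    fun n d L hn hL => ?_⟩
  · obtain ⟨c, hc, h⟩ := DistOpt.exists_isHardInstance.{v} hκ₀
    refine ⟨3 / 64 * c, 1 / 16, 12, by positivity, by norm_num, by norm_num,
      fun L μ Δ ω ε hμ hL hΔ hω hε hεΔ => ?_⟩
    obtain ⟨d₀, hd₀⟩ := h L μ Δ ω ε hμ hL hΔ.le hω hε hεΔ
    refine ⟨d₀, fun d hd n hn => ?_⟩
    obtain ⟨f, C, hf, hC⟩ := hd₀ d hd n hn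
    exact ⟨f, C, hf, hC.isUnbiased, fun r hr => ⟨hC.bitCost_eq r, hC.perRoundCost_le r hr⟩,
      fun A hA => ⟨by simpa only [mul_assoc] using hC.ofReal_const_mul_le_rounds hA,
        fun r hr => hC.ofReal_const_mul_le_tcc (by omega) hω hr hA⟩⟩
  · obtain ⟨c, hc, h⟩ := DistOpt.exists_isHardInstance_zero.{v}
    refine ⟨3 / 64 * c, 1 / 32, 12, by positivity, by norm_num, by norm_num,
      fun L Δ ω ε _ hΔ hω hε hεΔ => ?_⟩
    obtain ⟨d₀, hd₀⟩ := h L Δ ω ε hΔ hω hε hεΔ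
    refine ⟨d₀, fun d hd n hn => ?_⟩
    obtain ⟨f, C, hf, hC⟩ := hd₀ d hd n hn
    exact ⟨f, C, hf, hC.isUnbiased, fun r hr => ⟨hC.bitCost_eq r, hC.perRoundCost_le r hr⟩,
      fun A hA => ⟨hC.ofReal_const_mul_le_rounds hA,
        fun r hr => hC.ofReal_const_mul_le_tcc (by omega) hω hr hA⟩⟩
  · exact ⟨DistOpt.acceleratedGradient n d L μ, fun Δ f hf =>
      ⟨DistOpt.acceleratedGradient.linearSpanning f, fun ε r hε hεΔ _ =>
        hf.tcc_acceleratedGradient_le hn hμ hL r hε hεΔ⟩⟩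
  · refine ⟨DistOpt.acceleratedGradient n d L 0, fun Δ f hf =>
      ⟨DistOpt.acceleratedGradient.linearSpanning f, fun ε r hε hεΔ _ => ?_⟩⟩
    have hLΔ : 0 < L * Δ := pos_of_mul_pos_right (hε.trans_le hεΔ) (Real.exp_pos _).le
    exact hf.tcc_acceleratedGradient_zero_le hn hL r hε
      (hεΔ.trans (mul_le_of_le_one_left hLΔ.le (Real.exp_le_one_iff.mpr (by norm_num))))
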